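/- **Corollary.** Let $L$ be a (one-sorted) metric language, i.e. a set of function symbols and predicate symbols with arities and moduli of uniform continuity together with a symbol $\underline d$ for the metric, and fix a numbering of the symbols of $L$ by natural numbers. Let $\mathcal M$ be an interpretation of $L$: a nonempty metric space of diameter at most $1$, in which the function symbols are interpreted by functions and the predicate symbols by $[0,1]$-valued functions that respect the moduli. *Infinitary formulas.* Formulas are built from the atomic formulas $\underline d(s,t)$ and $P(t_1,\dots,t_n)$ and are evaluated in $[0,1]$, with $(\neg\varphi)^{\mathcal M}=1-\varphi^{\mathcal M}$, $(\tfrac12\varphi)^{\mathcal M}=\tfrac12\varphi^{\mathcal M}$, $(\varphi\mathbin{\dot-}\psi)^{\mathcal M}=\max(\varphi^{\mathcal M}-\psi^{\mathcal M},0)$, quantifiers $\inf_x$ and $\sup_x$, and countable disjunctions (infima) and conjunctions (suprema). The *computable infinitary formulas* and their codes are defined by recursion along Kleene's system $\mathcal O$ of notations. The computable $\Sigma_0$ and $\Pi_0$ formulas are the finitary quantifier-free formulas, with codes given by a standard coding of finite expressions based on the numbering of the symbols. For $a\in\mathcal O$ with $|a|_{\mathcal O}=\alpha>0$, a computable $\Sigma_\alpha$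 formula with free variables among $x_0,\dots,x_{n-1}$ is a disjunction over a nonempty c.e. set $W_e$, each of whose elements $\langle k,j\rangle$ stands for a formula $\inf_{x_n}\cdots\inf_{x_{n+k-1}}\psi$ with $j$ a code of a computable $\Pi_{|b|}$ formula $\psi$ for some $b<_{\mathcal O}a$; its code is the tuple $\langle\Sigma,a,n,e\rangle$. Computable $\Pi_\alpha$ formulas and their codes are defined dually, with $\sup$ and conjunctions. A computable infinitary sentence is such a formula without free variables, for some $a \in \mathcal O$. *Computing the theory.* An oracle $X\subseteq\mathbb N$ *computes the computable infinitary theory* $\operatorname{Th}^C_{\omega_1\omega}(\mathcal M)$, the map $\Phi\mapsto\Phi^{\mathcal M}$ on computable infinitary sentences, if $X$ computes a partial function $f:\subseteq\mathbb N^2\to\mathbb Q$ such that, whenever $c$ is a code of a computable infinitary sentence $\Phi$ and $k\in\mathbb N$, the value $f(c,k)$ is defined and $|f(c,k)-\Phi^{\mathcal M}|<2^{-k}$. *Hyperarithmetic sets.* Put $H(1)=\emptyset$, $H(2^a)=H(a)'$ (Turing jump) and $H(3\cdot5^e)=\{\langle u,v\rangle: u<_{\mathcal O}3\cdot 5^e,\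 v\in H(u)\}$ for notations in $\mathcal O$. A set is hyperarithmetic if it is computable from $H(a)$ for some $a\in\mathcal O$. Then: 1. every $X\subseteq\mathbb N$ that computes $\operatorname{Th}^C_{\omega_1\omega}(\mathcal M)$ computes every hyperarithmetic set; 2. no hyperarithmetic set computes $\operatorname{Th}^C_{\omega_1\omega}(\mathcal M)$. -/

import Mathlib

universe u v w

namespace HypNum

noncomputable section

/-! ### Computability: sets as oracles, the jump, notations for ordinals, hyperarithmetic sets -/

open Classical in
/-- The characteristic function of a set of natural numbers. -/
def char (X : Set ℕ) : ℕ →. ℕ := fun n => Part.some (if n ∈ X then 1 else 0)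

/-- `SetTuringLE Y X`: the set `X` computes the set `Y`. -/
def SetTuringLE (Y X : Set ℕ) : Prop := TuringReducible (char Y) (char X)

/-- The `e`-th partial computable function. -/
def phi (e : ℕ) : ℕ →. ℕ := (Denumerable.ofNat Nat.Partrec.Code e).eval

/-- The `e`-th computably enumerable set. -/
def W (e : ℕ) : Set ℕ := {n | (phi e n).Dom}

/-- The `e`-th set computably enumerable in the oracle `X` (Rogers' form of relative
enumerability): `W e` is read as a list of axioms `⟨n, q⟩`, where `q` is a finite list of oracle
questions with their answers, and `n` is enumerated from `X` if for some axiom `⟨n, q⟩` all the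
answers recorded in `q` are the ones that `X` gives. -/
def WRel (e : ℕ) (X : Set ℕ) : Set ℕ :=
  {n | ∃ q : List (ℕ × Bool), Nat.pair n (Encodable.encode q) ∈ W e ∧
    ∀ p ∈ q, (p.1 ∈ X ↔ p.2 = true)}

/-- The Turing jump. -/
def jump (X : Set ℕ) : Set ℕ := {e | e ∈ WRel e X}

/-- The least transitive relation that puts `a` below `2 ^ a` (for `a ≠ 0`) and every value of the
`e`-th partial computable function below `3 * 5 ^ e`. Below an element of Kleene's `𝒪` (see `InO`)
this is the ordering of `𝒪`. -/
inductive LtO : ℕ → ℕ → Prop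
  | succ {a : ℕ} : a ≠ 0 → LtO a (2 ^ a)
  | lim {e n m : ℕ} : m ∈ phi e n → LtO m (3 * 5 ^ e)
  | trans {a b c : ℕ} : LtO a b → LtO b c → LtO a c

/-- Kleene's set `𝒪` of notations for the computable ordinals. -/
inductive InO : ℕ → Prop
  | one : InO 1
  | succ {a : ℕ} : InO a → InO (2 ^ a)
  | lim {e : ℕ} (f : ℕ → ℕ) : (∀ n, f n ∈ phi e n) → (∀ n, InO (f n)) →
      (∀ n, LtO (f n) (f (n + 1))) → InO (3 * 5 ^ e)

/-- `IsH a X`: the set `X` is `H(a)`, where `H(1) = ∅`, `H(2 ^ a)` is the jump of `H(a)`, and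
`H(3 * 5 ^ e)` is the set of all `⟨u, v⟩` with `u` below `3 * 5 ^ e` and `v ∈ H(u)`. -/
inductive IsH : ℕ → Set ℕ → Prop
  | one : IsH 1 ∅
  | succ {a : ℕ} {X : Set ℕ} : IsH a X → IsH (2 ^ a) (jump X)
  | lim {e : ℕ} (Y : ℕ → Set ℕ) : (∀ u, LtO u (3 * 5 ^ e) → IsH u (Y u)) →
      IsH (3 * 5 ^ e) {x | LtO x.unpair.1 (3 * 5 ^ e) ∧ x.unpair.2 ∈ Y x.unpair.1}

theorem two_pow_ne_lim (a e : ℕ) : 2 ^ a ≠ 3 * 5 ^ e := by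
  intro h
  have h3 : 3 ∣ 2 ^ a := ⟨5 ^ e, h⟩
  have := Nat.prime_three.dvd_of_dvd_pow h3
  omega

theorem isH_pos {a : ℕ} {X : Set ℕ} (h : IsH a X) : 0 < a := by
  cases h <;> positivity

theorem isH_unique {a : ℕ} {X : Set ℕ} (h : IsH a X) : ∀ {X'}, IsH a X' → X = X' := by
  induction h with
  | one =>
    intro X' h'
    generalize hc : 1 = c at h'
    cases h' with
    | one => rfl
    | succ h1 =>
      have := isH_pos h1
      have := Nat.one_lt_two_pow this.ne'
      omega
    | @lim e Y hY => exact absurd hc (two_pow_ne_lim 0 e)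
  | @succ a X h1 ih =>
    intro X' h'
    generalize hc : 2 ^ a = c at h'
    cases h' with
    | one =>
      have := isH_pos h1
      have := Nat.one_lt_two_pow this.ne'
      omega
    | @succ a' Z h2 =>
      obtain rfl : a = a' := Nat.pow_right_injective le_rfl hc
      rw [ih h2]
    | @lim e Y hY => exact absurd hc (two_pow_ne_lim a e)
  | @lim e Y hY ih =>
    intro X' h'
    generalize hc : 3 * 5 ^ e = c at h'
    cases h' with
    | one => exact absurd hc.symm (two_pow_ne_lim 0 e)
    | @succ a' Z h2 => exact absurd hc.symm (two_pow_ne_lim a' e)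
    | @lim e' Y' hY' =>
      obtain rfl : e = e' :=
        Nat.pow_right_injective (show 2 ≤ 5 by simp) (Nat.eq_of_mul_eq_mul_left (by simp) hc)
      ext x
      exact and_congr_right fun hx => by rw [ih _ hx (hY' _ hx)]

theorem ltO_cases {a c : ℕ} (h : LtO a c) :
    (∃ b, b ≠ 0 ∧ c = 2 ^ b ∧ (a = b ∨ LtO a b)) ∨
      (∃ e n m, c = 3 * 5 ^ e ∧ m ∈ phi e n ∧ (a = m ∨ LtO a m)) := by
  induction h with
  | succ h => exact .inl ⟨_, h, rfl, .inl rfl⟩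
  | lim h => exact .inr ⟨_, _, _, rfl, h, .inl rfl⟩
  | trans h1 _ _ ih2 =>
    rcases ih2 with ⟨b, hb, hc, rfl | h⟩ | ⟨e, n, m, hc, hm, rfl | h⟩
    · exact .inl ⟨_, hb, hc, .inr h1⟩
    · exact .inl ⟨_, hb, hc, .inr (h1.trans h)⟩
    · exact .inr ⟨_, _, _, hc, hm, .inr h1⟩
    · exact .inr ⟨_, _, _, hc, hm, .inr (h1.trans h)⟩

/-- Below a notation there are only notations, and `H` is defined at all of them. -/
theorem exists_isH_le {a : ℕ} (h : InO a) :
    ∀ b, b = a ∨ LtO b a → InO b ∧ ∃ X, IsH b X := by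
  have key : ∀ {a : ℕ}, InO a → (∀ b, LtO b a → InO b ∧ ∃ X, IsH b X) → (∃ X, IsH a X) →
      ∀ b, b = a ∨ LtO b a → InO b ∧ ∃ X, IsH b X := by
    rintro a ha h1 h2 b (rfl | hb)
    exacts [⟨ha, h2⟩, h1 b hb]
  induction h with
  | one =>
    refine key .one (fun b hb => ?_) ⟨_, .one⟩
    rcases ltO_cases hb with ⟨c, hc, h, -⟩ | ⟨e, n, m, h, -⟩
    · have := Nat.one_lt_two_pow hc
      omega
    · exact absurd h (two_pow_ne_lim 0 e)
  | @succ a ha ih =>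
    refine key ha.succ (fun b hb => ?_) ?_
    · rcases ltO_cases hb with ⟨c, hc, h, hbc⟩ | ⟨e, n, m, h, -⟩
      · obtain rfl : a = c := Nat.pow_right_injective le_rfl h
        exact ih b hbc
      · exact absurd h (two_pow_ne_lim a e)
    · obtain ⟨-, X, hX⟩ := ih a (.inl rfl)
      exact ⟨_, hX.succ⟩
  | @lim e f hf hO hlt ih =>
    have h1 : ∀ b, LtO b (3 * 5 ^ e) → InO b ∧ ∃ X, IsH b X := by
      intro b hb
      rcases ltO_cases hb with ⟨c, hc, h, hbc⟩ | ⟨e', n, m, h, hm, hbm⟩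
      · exact absurd h.symm (two_pow_ne_lim c e)
      · obtain rfl : e = e' :=
          Nat.pow_right_injective (show 2 ≤ 5 by simp) (Nat.eq_of_mul_eq_mul_left (by simp) h)
        obtain rfl := Part.mem_unique hm (hf n)
        exact ih n b hbm
    refine key (.lim f hf hO hlt) h1 ?_
    choose! Y hY using fun b hb => (h1 b hb).2
    exact ⟨_, .lim Y hY⟩

/-- `H` is a well defined function on the set of notations. -/
theorem existsUnique_isH {a : ℕ} (h : InO a) : ∃! X, IsH a X := by
  obtain ⟨-, X, hX⟩ := exists_isH_le h a (.inl rfl)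
  exact ⟨X, hX, fun _ h' => isH_unique h' hX⟩

/-- A set is hyperarithmetic if it is computable from `H(a)` for some notation `a`. -/
def Hyperarithmetic (Z : Set ℕ) : Prop :=
  ∃ a X, InO a ∧ IsH a X ∧ SetTuringLE Z X

/-! ### Metric languages, their structures, and infinitary continuous logic -/

/-- A (one-sorted) metric language: function and predicate symbols with their arities and moduli of
uniform continuity. The symbol for the metric is treated as a logical symbol. -/
structure MetricLanguage where
  Func : Type u
  funcArity : Func → ℕ
  funcModulus : Func → ℝ → ℝ
  funcModulus_pos : ∀ f ε, 0 < ε → ε ≤ 1 → 0 < funcModulus f ε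
  Pred : Type v
  predArity : Pred → ℕ
  predModulus : Pred → ℝ → ℝ
  predModulus_pos : ∀ P ε, 0 < ε → ε ≤ 1 → 0 < predModulus P ε

/-- A numbering of the symbols of a metric language. -/
structure MetricLanguage.Numbering (L : MetricLanguage.{u, v}) where
  func : ℕ → Option L.Func
  func_surj : ∀ f, ∃ k, func k = some f
  pred : ℕ → Option L.Pred
  pred_surj : ∀ P, ∃ k, pred k = some P

/-- The space of truth values `[0, 1]`, a complete lattice; `0` is truth and `1` is falsity. -/
abbrev Truth : Type := Set.Icc (0 : ℝ) 1

/-- An interpretation of `L` (a metric structure) on the metric space `M` of diameter at most `1`. -/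
structure Interpretation (L : MetricLanguage.{u, v}) (M : Type w) [MetricSpace M] where
  dist_le_one : ∀ x y : M, dist x y ≤ 1
  func : (f : L.Func) → (Fin (L.funcArity f) → M) → M
  func_modulus : ∀ f (ε : ℝ), 0 < ε → ε ≤ 1 → ∀ x y : Fin (L.funcArity f) → M,
    (∀ i, dist (x i) (y i) < L.funcModulus f ε) → dist (func f x) (func f y) ≤ ε
  pred : (P : L.Pred) → (Fin (L.predArity P) → M) → Truth
  pred_modulus : ∀ P (ε : ℝ), 0 < ε → ε ≤ 1 → ∀ x y : Fin (L.predArity P) → M,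
    (∀ i, dist (x i) (y i) < L.predModulus P ε) → |(pred P x : ℝ) - pred P y| ≤ ε

/-- Terms of `L` with variables among `x_0, …, x_{n-1}`. -/
inductive Term (L : MetricLanguage.{u, v}) (n : ℕ) : Type u
  | var : Fin n → Term L n
  | app : (f : L.Func) → (Fin (L.funcArity f) → Term L n) → Term L n

/-- Infinitary formulas of `L` with free variables among `x_0, …, x_{n-1}`: the connectives are
`¬`, `½`, `∸`, the quantifiers `inf_{x_n}` and `sup_{x_n}`, and the disjunctions and conjunctions
of families indexed by sets of natural numbers. -/
inductive Formula (L : MetricLanguage.{u, v}) : ℕ → Type (max u v)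
  | dist {n : ℕ} : Term L n → Term L n → Formula L n
  | pred {n : ℕ} : (P : L.Pred) → (Fin (L.predArity P) → Term L n) → Formula L n
  | neg {n : ℕ} : Formula L n → Formula L n
  | half {n : ℕ} : Formula L n → Formula L n
  | monus {n : ℕ} : Formula L n → Formula L n → Formula L n
  | inf {n : ℕ} : Formula L (n + 1) → Formula L n
  | sup {n : ℕ} : Formula L (n + 1) → Formula L n
  | disj {n : ℕ} (S : Set ℕ) : (S → Formula L n) → Formula L n
  | conj {n : ℕ} (S : Set ℕ) : (S → Formula L n) → Formula L n

/-- The formula with the block of quantifiers `inf_{x_n} ⋯ inf_{x_{n+k-1}}` in front. -/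
def Formula.infBlock {L : MetricLanguage.{u, v}} {n : ℕ} : (k : ℕ) → Formula L (n + k) → Formula L n
  | 0, φ => φ
  | k + 1, φ => Formula.infBlock k (Formula.inf φ)

/-- The formula with the block of quantifiers `sup_{x_n} ⋯ sup_{x_{n+k-1}}` in front. -/
def Formula.supBlock {L : MetricLanguage.{u, v}} {n : ℕ} : (k : ℕ) → Formula L (n + k) → Formula L n
  | 0, φ => φ
  | k + 1, φ => Formula.supBlock k (Formula.sup φ)

section Semantics

variable {L : MetricLanguage.{u, v}} {M : Type w} [MetricSpace M]

/-- The value of a term. -/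
def Term.val (I : Interpretation L M) {n : ℕ} (x : Fin n → M) : Term L n → M
  | .var i => x i
  | .app f t => I.func f fun i => (t i).val I x

/-- The truth value of a formula. Disjunctions are infima and conjunctions are suprema in
`[0, 1]`. -/
def Formula.val (I : Interpretation L M) : {n : ℕ} → Formula L n → (Fin n → M) → Truth
  | _, .dist s t, x => ⟨Dist.dist (s.val I x) (t.val I x), dist_nonneg, I.dist_le_one _ _⟩
  | _, .pred P t, x => I.pred P fun i => (t i).val I x
  | _, .neg φ, x => ⟨1 - φ.val I x, by have := (φ.val I x).2; constructor <;> linarith [this.1, this.2]⟩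
  | _, .half φ, x => ⟨φ.val I x / 2, by have := (φ.val I x).2; constructor <;> linarith [this.1, this.2]⟩
  | _, .monus φ ψ, x => ⟨max ((φ.val I x : ℝ) - ψ.val I x) 0, le_max_right _ _, by
      have := (φ.val I x).2
      have := (ψ.val I x).2
      exact max_le (by linarith [(φ.val I x).2.2, (ψ.val I x).2.1]) zero_le_one⟩
  | _, .inf φ, x => ⨅ a : M, φ.val I (Fin.snoc x a)
  | _, .sup φ, x => ⨆ a : M, φ.val I (Fin.snoc x a)
  | _, .disj _ φ, x => ⨅ m, (φ m).val I x
  | _, .conj _ φ, x => ⨆ m, (φ m).val I x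

/-- The truth value of a sentence. -/
def Formula.truth (I : Interpretation L M) (Φ : Formula L 0) : ℝ := Φ.val I Fin.elim0

end Semantics

/-! ### Computable infinitary formulas and their codes -/

section Codes

variable {L : MetricLanguage.{u, v}}

/-- `TermCode ν n c t`: the number `c` is a code of the term `t`. -/
inductive TermCode (ν : L.Numbering) (n : ℕ) : ℕ → Term L n → Prop
  | var (i : Fin n) : TermCode ν n (Nat.pair 0 i) (.var i)
  | app {k : ℕ} {f : L.Func} (c : Fin (L.funcArity f) → ℕ) (t : Fin (L.funcArity f) → Term L n) :
      ν.func k = some f → (∀ i, TermCode ν n (c i) (t i)) →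
      TermCode ν n (Nat.pair 1 (Nat.pair k (Encodable.encode (List.ofFn c)))) (.app f t)

/-- `QFCode ν n c φ`: the number `c` is a code of the finitary quantifier-free formula `φ`. -/
inductive QFCode (ν : L.Numbering) (n : ℕ) : ℕ → Formula L n → Prop
  | dist {c d : ℕ} {s t : Term L n} : TermCode ν n c s → TermCode ν n d t →
      QFCode ν n (Nat.pair 0 (Nat.pair c d)) (.dist s t)
  | pred {k : ℕ} {P : L.Pred} (c : Fin (L.predArity P) → ℕ) (t : Fin (L.predArity P) → Term L n) :
      ν.pred k = some P → (∀ i, TermCode ν n (c i) (t i)) →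
      QFCode ν n (Nat.pair 1 (Nat.pair k (Encodable.encode (List.ofFn c)))) (.pred P t)
  | neg {c : ℕ} {φ : Formula L n} : QFCode ν n c φ → QFCode ν n (Nat.pair 2 c) (.neg φ)
  | half {c : ℕ} {φ : Formula L n} : QFCode ν n c φ → QFCode ν n (Nat.pair 3 c) (.half φ)
  | monus {c d : ℕ} {φ ψ : Formula L n} : QFCode ν n c φ → QFCode ν n d ψ →
      QFCode ν n (Nat.pair 4 (Nat.pair c d)) (.monus φ ψ)

/-- `CompCode ν true a n c φ` (resp. `CompCode ν false a n c φ`): the number `c` is a code of the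
computable `Σ_α` (resp. `Π_α`) formula `φ` with free variables among `x_0, …, x_{n-1}`, where `α` is
the ordinal with notation `a`. At `α = 0` these are the finitary quantifier-free formulas. For
`α > 0`, a computable `Σ_α` formula is a disjunction over a nonempty c.e. set `W e` whose elements
`⟨k, j⟩` stand for `inf_{x_n} ⋯ inf_{x_{n+k-1}} ψ` with `j` a code of a computable `Π_β` formula `ψ`
for some `β < α`; computable `Π_α` formulas are defined dually. -/
inductive CompCode (ν : L.Numbering) : Bool → ℕ → (n : ℕ) → ℕ → Formula L n → Prop
  | qf {s : Bool} {n c : ℕ} {φ : Formula L n} : QFCode ν n c φ → CompCode ν s 1 n c φ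
  | sigma {a n e : ℕ} : InO a → (W e).Nonempty →
      (b : W e → ℕ) → (∀ m, LtO (b m) a) →
      (ψ : (m : W e) → Formula L (n + (m : ℕ).unpair.1)) →
      (∀ m, CompCode ν false (b m) (n + (m : ℕ).unpair.1) (m : ℕ).unpair.2 (ψ m)) →
      CompCode ν true a n (Nat.pair 5 (Nat.pair a (Nat.pair n e)))
        (.disj (W e) fun m => (ψ m).infBlock (m : ℕ).unpair.1)
  | pi {a n e : ℕ} : InO a → (W e).Nonempty →
      (b : W e → ℕ) → (∀ m, LtO (b m) a) →
      (ψ : (m : W e) → Formula L (n + (m : ℕ).unpair.1)) →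
      (∀ m, CompCode ν true (b m) (n + (m : ℕ).unpair.1) (m : ℕ).unpair.2 (ψ m)) →
      CompCode ν false a n (Nat.pair 6 (Nat.pair a (Nat.pair n e)))
        (.conj (W e) fun m => (ψ m).supBlock (m : ℕ).unpair.1)

/-- The number `c` is a code of the computable infinitary sentence `Φ`. -/
def IsSentenceCode (ν : L.Numbering) (c : ℕ) (Φ : Formula L 0) : Prop :=
  ∃ s a, CompCode ν s a 0 c Φ

/-- A computable enumeration of the rational numbers. -/
def ratEnum (m : ℕ) : ℚ :=
  ((m.unpair.1.unpair.1 : ℚ) - m.unpair.1.unpair.2) / (m.unpair.2 + 1)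

/-- The oracle `X` computes the computable infinitary theory of the structure `I`: it computes a
partial function `f` with rational values such that `f (c, k)` is defined and within `2^{-k}` of
the truth value of `Φ` whenever `c` is a code of the computable infinitary sentence `Φ`. -/
def ComputesTheory (ν : L.Numbering) {M : Type w} [MetricSpace M] (I : Interpretation L M)
    (X : Set ℕ) : Prop :=
  ∃ f : ℕ → ℕ →. ℕ, RecursiveIn₂ {char X} f ∧
    ∀ (c : ℕ) (Φ : Formula L 0), IsSentenceCode ν c Φ → ∀ k : ℕ,
      ∃ m ∈ f c k, |(ratEnum m : ℝ) - Φ.truth I| < 2⁻¹ ^ k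

end Codes

end

end HypNum

namespace HypNum

open Nat.Partrec (Code)
open Denumerable (ofNat)
open Filter

/-! Membership in `H(a)` can be expressed by sentences that ignore the structure. Uniformly in a
notation `a` and a number `v` one computes a code of a computable infinitary sentence with value `0`
if `v ∈ H(a)` and `1` otherwise, in every nonempty structure (`exists_membership_code`). An oracle
for the theory approximates this value to within `1/4` and so decides `H(a)`
(`setTuringLE_of_computesTheory`); this gives the first claim. If moreover the oracle were
computable from some `H(a)`, then `H(2^a)`, the jump of `H(a)`, would be computable from `H(a)`,
against `not_setTuringLE_jump`.

The sentences come from a game in which disjunctions and conjunctions alternate. A number `v` is in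
the jump of `H(b)` if some axiom for `v` in `W v` records only correct answers about `H(b)`; at a
limit notation, membership is membership in an earlier `H(u)`. These equivalences are the rules of
the game (`claim_iff_of_step`). One level of the hierarchy can cost three moves, whereas a formula
must use a strictly smaller notation after each move, so notations are stretched first
(`exists_stretch`). The recursion theorem makes the codes of all positions computable at once
(`exists_game_code`), and induction along the notations evaluates the sentences (`hasTruth_game`).

The jump is defined through finite axioms, so the diagonal argument needs the use principle: a
halting oracle computation depends on finitely many oracle values (`exists_approximates`,
`exists_wRel_eq`). -/

/-! ### Indices of partial computable functions -/

/-- The result of the `e`-th partial computable function at `n`. -/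
def run (e n : ℕ) : Part ℕ := phi e n

theorem mem_W {e n : ℕ} : n ∈ W e ↔ (run e n).Dom := Iff.rfl

theorem partrec₂_run : Partrec₂ run :=
  Code.eval_part.comp ((Computable.ofNat Code).comp Computable.fst) Computable.snd

/-- The s-m-n theorem. -/
theorem exists_computable_index {α : Type*} [Primcodable α] {f : α → ℕ → Part ℕ}
    (hf : Partrec₂ f) :
    ∃ g : α → ℕ, Computable g ∧ g.Injective ∧ ∀ a n, run (g a) n = f a n := by
  obtain ⟨c, hc⟩ := Code.exists_code.1 hf
  refine ⟨fun a => Encodable.encode (c.curry (Encodable.encode a)),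
    Computable.encode.comp
      ((Code.primrec₂_curry.to_comp).comp (Computable.const c) Computable.encode),
    fun a b h => Encodable.encode_injective (Code.curry_inj (Encodable.encode_injective h)).2,
    fun a n => ?_⟩
  simp [run, phi, hc, Part.map_id', Code.eval_curry]

/-- Kleene's recursion theorem. -/
theorem exists_run_eq_self {f : ℕ → ℕ → Part ℕ} (hf : Partrec₂ f) :
    ∃ e, ∀ n, run e n = f e n := by
  obtain ⟨c, hc⟩ := Code.fixed_point₂ (f := fun c => f (Encodable.encode c))
    (hf.comp (Computable.encode.comp Computable.fst) Computable.snd)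
  exact ⟨Encodable.encode c, fun n => by simp [run, phi, hc]⟩

theorem exists_run_eq {f : ℕ → Part ℕ} (hf : Partrec f) : ∃ e, ∀ n, run e n = f n := by
  obtain ⟨c, hc⟩ := Code.exists_code.1 (Partrec.nat_iff.1 hf)
  exact ⟨Encodable.encode c, fun n => by simp [run, phi, hc]⟩

theorem mem_rfind_some {p : ℕ → Bool} {n : ℕ} :
    n ∈ Nat.rfind (fun k => Part.some (p k)) ↔ p n = true ∧ ∀ m < n, p m = false := by
  refine Nat.mem_rfind.trans ?_
  exact and_congr (Part.mem_some_iff.trans eq_comm)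
    (forall₂_congr fun _ _ => Part.mem_some_iff.trans eq_comm)

theorem rfind_some_dom {p : ℕ → Bool} :
    (Nat.rfind (fun k => Part.some (p k))).Dom ↔ ∃ n, p n = true := by
  refine Nat.rfind_dom.trans ?_
  refine exists_congr fun n => ?_
  exact (and_iff_left fun {_} _ => trivial).trans (Part.mem_some_iff.trans eq_comm)

/-- Formulas index their members by domains `W e`, but the game produces members by enumeration. To
pass from one to the other, search for a stage and an input at which `m` appears as output. -/
theorem exists_W_eq_range :
    ∃ r : ℕ → ℕ, Computable r ∧ r.Injective ∧ ∀ e, W (r e) = {m | ∃ i, m ∈ run e i} := by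
  have hf : Partrec₂ fun e m : ℕ => Nat.rfind fun k : ℕ =>
      Part.some (decide (Code.evaln k.unpair.1 (ofNat Code e) k.unpair.2 = some m)) := by
    refine Partrec.rfind (Computable.partrec (Primrec.to_comp ?_))
    refine PrimrecPred.decide (Primrec.eq.comp (Code.primrec_evaln.comp (.pair (.pair
      (Primrec.fst.comp (Primrec.unpair.comp .snd))
      ((Primrec.ofNat Code).comp (Primrec.fst.comp .fst)))
      (Primrec.snd.comp (Primrec.unpair.comp .snd)))) (Primrec.option_some.comp
        (Primrec.snd.comp .fst)))
  obtain ⟨r, hr, hinj, h⟩ := exists_computable_index hf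
  refine ⟨r, hr, hinj, fun e => ?_⟩
  ext m
  change (run (r e) m).Dom ↔ ∃ i, m ∈ run e i
  rw [h]
  refine rfind_some_dom.trans ?_
  simp only [decide_eq_true_eq, run, phi, Code.evaln_complete]
  constructor
  · rintro ⟨k, hk⟩
    exact ⟨k.unpair.2, k.unpair.1, hk⟩
  · rintro ⟨i, k, hk⟩
    exact ⟨Nat.pair k i, by simpa using hk⟩

/-! ### Computing with the two forms of notations. -/

theorem primrec₂_pow : Primrec₂ fun a b : ℕ => a ^ b := Primrec₂.unpaired'.1 Nat.Primrec.pow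

theorem computable_two_pow : Computable fun a : ℕ => 2 ^ a :=
  (primrec₂_pow.comp (Primrec.const 2) .id).to_comp

theorem computable_three_mul_five_pow : Computable fun a : ℕ => 3 * 5 ^ a :=
  (Primrec.nat_mul.comp (Primrec.const 3) (primrec₂_pow.comp (Primrec.const 5) .id)).to_comp

/-- Case distinction on the form of a notation: `f b` at `2 ^ b` and `g e` at `3 * 5 ^ e`. -/
def notationCases {σ : Type*} (f g : ℕ → Part σ) (c : ℕ) : Part σ :=
  (Nat.rfind fun k => Part.some (decide (2 ^ k = c ∨ 3 * 5 ^ k = c))).bind fun k =>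
    bif decide (2 ^ k = c) then f k else g k

theorem mem_notationCases {σ : Type*} {f g : ℕ → Part σ} {c : ℕ} {x : σ} :
    x ∈ notationCases f g c ↔ (∃ b, c = 2 ^ b ∧ x ∈ f b) ∨ ∃ e, c = 3 * 5 ^ e ∧ x ∈ g e := by
  have inj2 : ∀ {a b : ℕ}, 2 ^ a = 2 ^ b → a = b := fun h => Nat.pow_right_injective le_rfl h
  have inj5 : ∀ {a b : ℕ}, 3 * 5 ^ a = 3 * 5 ^ b → a = b := fun h =>
    Nat.pow_right_injective (show 2 ≤ 5 by simp) (Nat.eq_of_mul_eq_mul_left (by simp) h)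
  simp only [notationCases, Part.mem_bind_iff, mem_rfind_some, decide_eq_true_eq,
    decide_eq_false_iff_not]
  constructor
  · rintro ⟨k, ⟨hk, -⟩, hx⟩
    rcases hk with h | h
    · exact .inl ⟨k, h.symm, by simpa [h] using hx⟩
    · refine .inr ⟨k, h.symm, ?_⟩
      have : ¬ 2 ^ k = c := fun h' => two_pow_ne_lim k k (h'.trans h.symm)
      simpa [this] using hx
  · rintro (⟨b, rfl, hx⟩ | ⟨e, rfl, hx⟩)
    · refine ⟨b, ⟨by simp, fun m hm => ?_⟩, by simpa using hx⟩
      rintro (h | h)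
      · exact hm.ne (inj2 h)
      · exact two_pow_ne_lim _ _ h.symm
    · refine ⟨e, ⟨by simp, fun m hm => ?_⟩, by simpa [two_pow_ne_lim] using hx⟩
      rintro (h | h)
      · exact two_pow_ne_lim _ _ h
      · exact hm.ne (inj5 h)

theorem notationCases_two_pow {σ : Type*} (f g : ℕ → Part σ) (b : ℕ) :
    notationCases f g (2 ^ b) = f b := by
  ext x
  rw [mem_notationCases]
  constructor
  · rintro (⟨b', h, hx⟩ | ⟨e, h, -⟩)
    · rwa [Nat.pow_right_injective le_rfl h]
    · exact absurd h (two_pow_ne_lim _ _)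
  · exact fun hx => .inl ⟨b, rfl, hx⟩

theorem notationCases_lim {σ : Type*} (f g : ℕ → Part σ) (e : ℕ) :
    notationCases f g (3 * 5 ^ e) = g e := by
  ext x
  rw [mem_notationCases]
  constructor
  · rintro (⟨b', h, hx⟩ | ⟨e', h, hx⟩)
    · exact absurd h.symm (two_pow_ne_lim _ _)
    · rwa [Nat.pow_right_injective (show 2 ≤ 5 by simp) (Nat.eq_of_mul_eq_mul_left (by simp) h)]
  · exact fun hx => .inr ⟨e, rfl, hx⟩

theorem partrec_notationCases {α σ : Type*} [Primcodable α] [Primcodable σ] {c : α → ℕ}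
    {f g : α → ℕ → Part σ} (hc : Computable c) (hf : Partrec₂ f) (hg : Partrec₂ g) :
    Partrec fun a => notationCases (f a) (g a) (c a) := by
  have h2 : Computable fun p : α × ℕ => decide (2 ^ p.2 = c p.1) :=
    (PrimrecPred.decide Primrec.eq).to_comp.comp
      ((computable_two_pow.comp .snd).pair (hc.comp .fst))
  have h3 : Computable fun p : α × ℕ => decide (3 * 5 ^ p.2 = c p.1) :=
    (PrimrecPred.decide Primrec.eq).to_comp.comp
      ((computable_three_mul_five_pow.comp .snd).pair (hc.comp .fst))
  refine Partrec.bind (Partrec.rfind (p := fun a k =>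
    Part.some (decide (2 ^ k = c a ∨ 3 * 5 ^ k = c a))) ?_) (Partrec.cond h2 hf hg)
  refine Computable.partrec ((Computable.cond h2 (Computable.const true) h3).of_eq fun p => ?_)
  by_cases h : 2 ^ p.2 = c p.1 <;> simp [h]

/-! ### Enumerating the notations below a notation, and stretching notations -/

/-- `LtO` is the transitive closure of a c.e. one-step relation `down`, so it suffices to enumerate
finite descending paths. -/
theorem exists_enum_ltO :
    ∃ f : ℕ → ℕ → Part ℕ, Partrec₂ f ∧ ∀ b a, LtO b a ↔ ∃ i, b ∈ f a i := by
  let down (c n : ℕ) : Part ℕ :=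
    notationCases (fun b => bif decide (b = 0) then Part.none else Part.some b)
      (fun e => run e n) c
  have mem_down : ∀ {b c : ℕ}, (∃ n, b ∈ down c n) ↔
      (b ≠ 0 ∧ c = 2 ^ b) ∨ ∃ e n, c = 3 * 5 ^ e ∧ b ∈ run e n := by
    intro b c
    simp only [down, mem_notationCases]
    constructor
    · rintro ⟨n, ⟨b', hc, hb⟩ | ⟨e, hc, hb⟩⟩
      · by_cases h0 : b' = 0
        · simp [h0] at hb
        · obtain rfl : b = b' := by simpa [h0] using hb
          exact .inl ⟨h0, hc⟩
      · exact .inr ⟨e, n, hc, hb⟩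
    · rintro (⟨h0, hc⟩ | ⟨e, n, hc, hb⟩)
      · exact ⟨0, .inl ⟨b, hc, by simp [h0]⟩⟩
      · exact ⟨n, .inr ⟨e, hc, hb⟩⟩
  have down_partrec : Partrec₂ down := by
    refine partrec_notationCases .fst ?_ ?_
    · exact Partrec.cond ((PrimrecPred.decide Primrec.eq).to_comp.comp
        (Computable.snd.pair (Computable.const 0))) Partrec.none Computable.snd.partrec
    · exact partrec₂_run.comp .snd (Computable.snd.comp .fst)
  -- A path from `a` is coded by `⟨n, 0⟩` for the single step `n`, and by `⟨n, j + 1⟩` for the step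
  -- `n` followed by the path `j`.
  obtain ⟨e, he⟩ := exists_run_eq_self (f := fun e p =>
      (down p.unpair.1 p.unpair.2.unpair.1).bind fun b =>
        p.unpair.2.unpair.2.casesOn (Part.some b) fun j => run e (Nat.pair b j)) <| by
    have h2 : Computable fun p : ℕ × ℕ => p.2.unpair.2 :=
      Computable.snd.comp (Computable.unpair.comp .snd)
    refine Partrec.bind (down_partrec.comp
      (Computable.fst.comp (Computable.unpair.comp .snd))
      (Computable.fst.comp (Computable.unpair.comp h2))) ?_
    refine Partrec.nat_casesOn_right (Computable.snd.comp (Computable.unpair.comp (h2.comp .fst)))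
      .snd (partrec₂_run.comp (Computable.fst.comp (Computable.fst.comp .fst))
        (Primrec₂.natPair.to_comp.comp (Computable.snd.comp .fst) .snd))
  refine ⟨fun a i => run e (Nat.pair a i), partrec₂_run.comp (Computable.const e)
    (Primrec₂.natPair.to_comp.comp .fst .snd), fun b a => ?_⟩
  have hzero : ∀ a n, run e (Nat.pair a (Nat.pair n 0)) = down a n := by
    intro a n
    rw [he]
    simp [Part.bind_some_right]
  have hsucc : ∀ a n j, run e (Nat.pair a (Nat.pair n (j + 1))) =
      (down a n).bind fun b => run e (Nat.pair b j) := by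
    intro a n j
    rw [he]
    simp
  have step : ∀ {b a : ℕ}, (∃ n, b ∈ down a n) → LtO b a := by
    intro b a h
    rcases mem_down.1 h with ⟨h0, rfl⟩ | ⟨e, n, rfl, hb⟩
    exacts [.succ h0, .lim hb]
  constructor
  · intro h
    have h' : Relation.TransGen (fun b a => ∃ n, b ∈ down a n) b a := by
      induction h with
      | succ h => exact .single (mem_down.2 (.inl ⟨h, rfl⟩))
      | lim h => exact .single (mem_down.2 (.inr ⟨_, _, rfl, h⟩))
      | trans _ _ h1 h2 => exact h1.trans h2
    clear h
    induction h' with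
    | single hd =>
      obtain ⟨n, hn⟩ := hd
      exact ⟨Nat.pair n 0, by simpa only [hzero] using hn⟩
    | tail hb hd ih =>
      obtain ⟨n, hn⟩ := hd
      obtain ⟨i, hi⟩ := ih
      exact ⟨Nat.pair n (i + 1), by simpa only [hsucc] using Part.mem_bind hn hi⟩
  · rintro ⟨i, hi⟩
    induction i using Nat.strong_induction_on generalizing a with
    | _ i ih =>
      obtain ⟨n, j, rfl⟩ : ∃ n j, i = Nat.pair n j := ⟨_, _, (Nat.pair_unpair i).symm⟩
      rcases j with _ | j
      · exact step ⟨n, hzero a n ▸ hi⟩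
      · simp only [hsucc, Part.mem_bind_iff] at hi
        obtain ⟨c, hc, hi⟩ := hi
        exact (ih j (Nat.right_le_pair n (j + 1)) c hi).trans (step ⟨n, hc⟩)

/-! ### The ordering below a notation. -/

theorem InO.pos {a : ℕ} (h : InO a) : 0 < a := by
  cases h <;> positivity

theorem InO.ltO_two_pow {a : ℕ} (h : InO a) : LtO a (2 ^ a) := .succ h.pos.ne'

theorem not_ltO_one {a : ℕ} : ¬ LtO a 1 := by
  intro h
  rcases ltO_cases h with ⟨b, hb, h, -⟩ | ⟨e, n, m, h, -⟩
  · exact (Nat.one_lt_two_pow hb).ne h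
  · exact two_pow_ne_lim 0 e h

theorem eq_or_ltO_of_ltO_two_pow {a b : ℕ} (h : LtO a (2 ^ b)) : a = b ∨ LtO a b := by
  rcases ltO_cases h with ⟨c, -, h, hc⟩ | ⟨e, n, m, h, -⟩
  · rwa [Nat.pow_right_injective le_rfl h]
  · exact absurd h (two_pow_ne_lim b e)

theorem exists_of_ltO_lim {a e : ℕ} (h : LtO a (3 * 5 ^ e)) :
    ∃ n, ∃ m ∈ run e n, a = m ∨ LtO a m := by
  rcases ltO_cases h with ⟨c, -, h, hc⟩ | ⟨e', n, m, h, hm, ham⟩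
  · exact absurd h.symm (two_pow_ne_lim c e)
  · obtain rfl : e = e' :=
      Nat.pow_right_injective (show 2 ≤ 5 by simp) (Nat.eq_of_mul_eq_mul_left (by simp) h)
    exact ⟨n, m, hm, ham⟩

theorem InO.of_ltO {a b : ℕ} (h : InO a) (hb : LtO b a) : InO b :=
  (exists_isH_le h b (.inr hb)).1

/-- Supplies the induction on notations that evaluates game sentences. Below a limit, every notation
is at or below a term of the fundamental sequence. -/
theorem InO.acc {a : ℕ} (h : InO a) : Acc LtO a := by
  induction h with
  | one => exact ⟨_, fun b hb => absurd hb not_ltO_one⟩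
  | succ _ ih =>
    refine ⟨_, fun b hb => ?_⟩
    rcases eq_or_ltO_of_ltO_two_pow hb with rfl | hb
    exacts [ih, ih.inv hb]
  | lim f hf _ _ ih =>
    refine ⟨_, fun b hb => ?_⟩
    obtain ⟨n, m, hm, hbm⟩ := exists_of_ltO_lim hb
    obtain rfl := Part.mem_unique hm (hf n)
    rcases hbm with rfl | hb
    exacts [ih n, (ih n).inv hb]

/-- There is a computable order preserving map on notations after which each notation is at least
two successors above the earlier ones. -/
theorem exists_stretch : ∃ t : ℕ → Part ℕ, Partrec t ∧ ∀ a, InO a → ∃ A ∈ t a, InO A ∧ LtO 1 A ∧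
    ∀ b, LtO b a → ∃ B ∈ t b, LtO (2 ^ 2 ^ B) A := by
  -- `comp (t, e)` is an index of the composition of the `t`-th function after the `e`-th.
  obtain ⟨comp, hcomp, -, hcomp'⟩ := exists_computable_index
    (α := ℕ × ℕ) (f := fun p n => (run p.2 n).bind (run p.1))
    (Partrec.bind (partrec₂_run.comp (Computable.snd.comp .fst) .snd)
      (partrec₂_run.comp (Computable.fst.comp (Computable.fst.comp .fst)) .snd))
  have h222 : Computable fun n : ℕ => 2 ^ 2 ^ 2 ^ n :=
    computable_two_pow.comp (computable_two_pow.comp computable_two_pow)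
  -- The start value `2` lies above `1`, where quantifier-free formulas live. Three successors per
  -- step leave `2 ^ 2 ^ A` strictly below the next value, and at limits the map is applied along
  -- the fundamental sequence.
  obtain ⟨t, ht⟩ := exists_run_eq_self (f := fun t a => notationCases
      (fun b => bif decide (b = 0) then Part.some 2 else (run t b).map fun n => 2 ^ 2 ^ 2 ^ n)
      (fun e => Part.some (3 * 5 ^ comp (t, e))) a) <| by
    refine partrec_notationCases .snd ?_ ?_
    · exact Partrec.cond ((PrimrecPred.decide Primrec.eq).to_comp.comp
        (Computable.snd.pair (Computable.const 0))) (Computable.const 2).partrec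
        (Partrec.map (partrec₂_run.comp (Computable.fst.comp .fst) .snd) (h222.comp .snd))
    · exact (computable_three_mul_five_pow.comp (hcomp.comp
        ((Computable.fst.comp .fst).pair .snd))).partrec
  have hone : 2 ∈ run t 1 := by
    rw [ht, show 1 = 2 ^ 0 from rfl, notationCases_two_pow]
    simp
  have hsucc : ∀ {a A : ℕ}, a ≠ 0 → A ∈ run t a → 2 ^ 2 ^ 2 ^ A ∈ run t (2 ^ a) := by
    intro a A ha hA
    rw [ht, notationCases_two_pow]
    simpa [ha] using hA
  have hlim : ∀ e, 3 * 5 ^ comp (t, e) ∈ run t (3 * 5 ^ e) := by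
    intro e
    rw [ht, notationCases_lim]
    simp
  refine ⟨run t, partrec₂_run.comp (Computable.const t) .id, fun a ha => ?_⟩
  have key : ∀ b, b = a ∨ LtO b a → ∃ B ∈ run t b, InO B ∧ LtO 1 B ∧
      ∀ c, LtO c b → ∃ C ∈ run t c, LtO (2 ^ 2 ^ C) B := by
    induction ha with
    | one =>
      rintro b (rfl | hb)
      · refine ⟨2, hone, InO.one.succ, .succ one_ne_zero, fun c hc => absurd hc not_ltO_one⟩
      · exact absurd hb not_ltO_one
    | @succ a h ih =>
      obtain ⟨A, hA, hAO, hA1, hAc⟩ := ih a (.inl rfl)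
      rintro b (rfl | hb)
      · refine ⟨_, hsucc h.pos.ne' hA, hAO.succ.succ.succ, ?_, fun c hc => ?_⟩
        · exact hA1.trans (hAO.ltO_two_pow.trans
            (hAO.succ.ltO_two_pow.trans hAO.succ.succ.ltO_two_pow))
        · rcases eq_or_ltO_of_ltO_two_pow hc with rfl | hc
          · exact ⟨A, hA, hAO.succ.succ.ltO_two_pow⟩
          · obtain ⟨C, hC, hCA⟩ := hAc c hc
            exact ⟨C, hC, hCA.trans (hAO.ltO_two_pow.trans
              (hAO.succ.ltO_two_pow.trans hAO.succ.succ.ltO_two_pow))⟩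
      · exact ih b (eq_or_ltO_of_ltO_two_pow hb)
    | @lim e f hf hO hlt ih =>
      have hcf : ∀ n A, A ∈ run t (f n) → A ∈ run (comp (t, e)) n := by
        intro n A hA
        rw [hcomp']
        exact Part.mem_bind (hf n) hA
      choose A hA hAO hA1 hAc using fun n => ih n (f n) (.inl rfl)
      -- Since `f` increases, the bound known at `f (n + 1)` applies to `f n`; hence the stretched
      -- sequence increases too.
      have hlt' : ∀ n, LtO (2 ^ 2 ^ A n) (A (n + 1)) := by
        intro n
        obtain ⟨C, hC, hCA⟩ := hAc (n + 1) (f n) (hlt n)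
        rwa [Part.mem_unique hC (hA n)] at hCA
      have hup : ∀ n, LtO (A n) (3 * 5 ^ comp (t, e)) := fun n => .lim (hcf n _ (hA n))
      rintro b (rfl | hb)
      · refine ⟨_, hlim e, InO.lim A (fun n => hcf n _ (hA n)) hAO fun n => ?_,
          (hA1 0).trans (hup 0), fun c hc => ?_⟩
        · exact (hAO n).ltO_two_pow.trans ((hAO n).succ.ltO_two_pow.trans (hlt' n))
        · obtain ⟨n, m, hm, hcm⟩ := exists_of_ltO_lim hc
          obtain rfl := Part.mem_unique hm (hf n)
          rcases hcm with rfl | hcm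
          · exact ⟨A n, hA n, (hlt' n).trans (hup _)⟩
          · obtain ⟨C, hC, hCA⟩ := hAc n c hcm
            exact ⟨C, hC, hCA.trans (hup n)⟩
      · obtain ⟨n, m, hm, hbm⟩ := exists_of_ltO_lim hb
        obtain rfl := Part.mem_unique hm (hf n)
        exact ih n b hbm
  exact key a (.inl rfl)

/-! ### Codes of sentences that describe computable games -/

/-- The code of a sentence that is a disjunction (`s = true`) or conjunction (`s = false`). -/
def node (s : Bool) (t e : ℕ) : ℕ := Nat.pair (bif s then 5 else 6) (Nat.pair t (Nat.pair 0 e))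

/-- The code of the quantifier-free formula `d(x_0, x_0)` or `¬ d(x_0, x_0)`. -/
def constCode (b : Bool) : ℕ :=
  bif b then Nat.pair 0 (Nat.pair (Nat.pair 0 0) (Nat.pair 0 0))
  else Nat.pair 2 (Nat.pair 0 (Nat.pair (Nat.pair 0 0) (Nat.pair 0 0)))

/-- A member of a disjunction (`s = true`) or conjunction (`s = false`) that does not affect its
value. -/
def neutral (s : Bool) : ℕ := Nat.pair 1 (constCode !s)

theorem node_injective {s s' : Bool} {t t' e e' : ℕ} (h : node s t e = node s' t' e') :
    e = e' := by
  simp only [node, Nat.pair_eq_pair] at h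
  exact h.2.2.2

/-- A code mentions only an index of the set of its members, so it can be written down before any
member is computed; the recursion theorem closes the circle. Injectivity of `e` lets the position be
recovered from its code. -/
theorem exists_game_code {α : Type*} [Primcodable α] {s : α → Bool} {τ : α → Part ℕ}
    {step : α → ℕ → Part α} (hs : Computable s) (hτ : Partrec τ) (hstep : Partrec₂ step) :
    ∃ (F : α → Part ℕ) (e : α → ℕ), Partrec F ∧ e.Injective ∧
      (∀ x, F x = (τ x).map fun t => node (s x) t (e x)) ∧
      ∀ x, W (e x) = {m | m = neutral (s x) ∨ ∃ i, ∃ y ∈ step x i, ∃ c ∈ F y, m = Nat.pair 0 c} := by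
  obtain ⟨r, hr, hrinj, hW⟩ := exists_W_eq_range
  -- `idx (c, x)` indexes the enumeration of members at position `x`, when `c` is a program that
  -- handles all positions.
  obtain ⟨idx, hidx, hidxinj, hrun⟩ := exists_computable_index (α := ℕ × α)
    (f := fun p i => run p.1 (Nat.pair (Encodable.encode p.2) i))
    (partrec₂_run.comp (Computable.fst.comp .fst)
      (Primrec₂.natPair.to_comp.comp (Computable.encode.comp (Computable.snd.comp .fst)) .snd))
  have hpair : Computable₂ Nat.pair := Primrec₂.natPair.to_comp
  have hnode : Computable fun p : Bool × ℕ × ℕ => node p.1 p.2.1 p.2.2 :=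
    hpair.comp (Computable.cond .fst (.const 5) (.const 6)) (hpair.comp (Computable.fst.comp .snd)
      (hpair.comp (.const 0) (Computable.snd.comp .snd)))
  have hneutral : Computable neutral :=
    hpair.comp (.const 1) (Computable.cond Primrec.not.to_comp (.const _) (.const _))
  let G (c : ℕ) (x : α) : Part ℕ := (τ x).map fun t => node (s x) t (r (idx (c, x)))
  have hG : Partrec₂ G := by
    refine Partrec.map (hτ.comp .snd) (hnode.comp ((hs.comp (Computable.snd.comp .fst)).pair
      (Computable.snd.pair (hr.comp (hidx.comp .fst)))))
  obtain ⟨c, hc⟩ := exists_run_eq_self (f := fun c n =>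
      (Encodable.decode (α := α) n.unpair.1 : Part α).bind fun x =>
        -- Input `0` yields the neutral member, which keeps the set nonempty even without moves;
        -- input `i + 1` yields the code reached by move `i`, if any.
        n.unpair.2.casesOn (Part.some (neutral (s x))) fun i =>
          (step x i).bind fun y => (G c y).map fun d => Nat.pair 0 d) <| by
    have hx : Computable fun p : ((ℕ × ℕ) × α) × ℕ => p.1.2 := Computable.snd.comp .fst
    refine Partrec.bind (Computable.ofOption (Computable.decode.comp
      (Computable.fst.comp (Computable.unpair.comp .snd)))) ?_
    refine Partrec.nat_casesOn_right
      (Computable.snd.comp (Computable.unpair.comp (Computable.snd.comp .fst)))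
      (hneutral.comp (hs.comp .snd)) ?_
    refine Partrec.bind (hstep.comp hx .snd) ?_
    refine Partrec.map (hG.comp
      (Computable.fst.comp (Computable.fst.comp (Computable.fst.comp .fst))) .snd) (hpair.comp (.const 0) .snd)
  refine ⟨G c, fun x => r (idx (c, x)), hG.comp (.const c) .id,
    fun x y h => (Prod.ext_iff.1 (hidxinj (hrinj h))).2, fun x => rfl, fun x => ?_⟩
  ext m
  rw [hW]
  simp only [hrun, hc, Set.mem_ofPred_eq, Nat.unpair_pair, Encodable.encodek, Part.coe_some,
    Part.bind_some]
  constructor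
  · rintro ⟨i, hi⟩
    rcases i with _ | i
    · exact .inl (by simpa using hi)
    · right
      simp only [Part.mem_bind_iff, Part.mem_map_iff] at hi
      obtain ⟨y, hy, d, hd, rfl⟩ := hi
      exact ⟨i, y, hy, d, hd, rfl⟩
  · rintro (rfl | ⟨i, y, hy, d, hd, rfl⟩)
    · exact ⟨0, by simp⟩
    · exact ⟨i + 1, Part.mem_bind hy (Part.mem_map _ hd)⟩

/-! ### Truth values of game sentences. -/

section Truth

variable {L : MetricLanguage.{u, v}} (ν : L.Numbering) {M : Type w} [MetricSpace M]
  (I : Interpretation L M)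

/-- The number `c` is a code of a computable `Σ_a` (resp. `Π_a`) sentence whose truth value is `0`
if `p` holds and `1` otherwise. -/
def HasTruth (s : Bool) (a c : ℕ) (p : Prop) : Prop :=
  ∃ φ : Formula L 0, CompCode ν s a 0 c φ ∧
    (p → φ.val I Fin.elim0 = ⊥) ∧ (¬ p → φ.val I Fin.elim0 = ⊤)

/-- A block of quantifiers `inf` (`s = true`) or `sup` (`s = false`). -/
def block (s : Bool) {n : ℕ} (k : ℕ) (φ : Formula L (n + k)) : Formula L n :=
  match s with
  | true => φ.infBlock k
  | false => φ.supBlock k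

/-- Like `HasTruth`, for the member `m` of a disjunction (`s = true`) or conjunction
(`s = false`). -/
def MemberHasTruth (s : Bool) (b m : ℕ) (p : Prop) : Prop :=
  ∃ ψ : Formula L (0 + m.unpair.1), CompCode ν (!s) b (0 + m.unpair.1) m.unpair.2 ψ ∧
    (p → (block s m.unpair.1 ψ).val I Fin.elim0 = ⊥) ∧
    (¬ p → (block s m.unpair.1 ψ).val I Fin.elim0 = ⊤)

variable {ν I}

theorem memberHasTruth_pair {s : Bool} {b k c : ℕ} {p : Prop} (ψ : Formula L (0 + k))
    (hψ : CompCode ν (!s) b (0 + k) c ψ) (h0 : p → (block s k ψ).val I Fin.elim0 = ⊥)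
    (h1 : ¬ p → (block s k ψ).val I Fin.elim0 = ⊤) :
    MemberHasTruth ν I s b (Nat.pair k c) p := by
  -- The type of the formula depends on `(Nat.pair k c).unpair`, so the pair is generalized before
  -- it is rewritten.
  have key : ∀ q : ℕ × ℕ, q = (k, c) → ∃ ψ : Formula L (0 + q.1),
      CompCode ν (!s) b (0 + q.1) q.2 ψ ∧ (p → (block s q.1 ψ).val I Fin.elim0 = ⊥) ∧
        (¬ p → (block s q.1 ψ).val I Fin.elim0 = ⊤) := by
    rintro _ rfl
    exact ⟨ψ, hψ, h0, h1⟩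
  exact key _ (Nat.unpair_pair k c)

theorem MemberHasTruth.congr {s : Bool} {b m : ℕ} {p q : Prop}
    (h : MemberHasTruth ν I s b m p) (hpq : p ↔ q) : MemberHasTruth ν I s b m q :=
  propext hpq ▸ h

theorem HasTruth.congr {s : Bool} {a c : ℕ} {p q : Prop}
    (h : HasTruth ν I s a c p) (hpq : p ↔ q) : HasTruth ν I s a c q :=
  propext hpq ▸ h

theorem HasTruth.member {s : Bool} {b c : ℕ} {p : Prop} (h : HasTruth ν I (!s) b c p) :
    MemberHasTruth ν I s b (Nat.pair 0 c) p := by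
  obtain ⟨φ, hφ, h0, h1⟩ := h
  cases s <;> exact memberHasTruth_pair (k := 0) φ hφ h0 h1

/-- The language may have no closed terms, so the constants are built from `d(x_0, x_0) = 0` under
one quantifier: value `1` is neutral for infima, value `0` for suprema. -/
theorem memberHasTruth_neutral [Nonempty M] (s : Bool) :
    MemberHasTruth ν I s 1 (neutral s) (s = false) := by
  have hd : QFCode ν (0 + 1) (Nat.pair 0 (Nat.pair (Nat.pair 0 0) (Nat.pair 0 0)))
      (.dist (.var 0) (.var 0) : Formula L (0 + 1)) := .dist (.var 0) (.var 0)
  cases s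
  · refine memberHasTruth_pair (k := 1) _ (.qf hd) (fun _ => ?_) (by simp)
    refine iSup_eq_bot.2 fun x => Subtype.ext ?_
    exact dist_self _
  · refine memberHasTruth_pair (k := 1) _ (.qf hd.neg) (by simp) (fun _ => ?_)
    refine iInf_eq_top.2 fun x => Subtype.ext ?_
    exact (congrArg (fun r : ℝ => 1 - r) (dist_self _)).trans (sub_zero 1)

theorem hasTruth_node_true {a e : ℕ} {p : ℕ → Prop} (ha : InO a) (hne : (W e).Nonempty)
    (h : ∀ m ∈ W e, ∃ b, LtO b a ∧ MemberHasTruth ν I true b m (p m)) :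
    HasTruth ν I true a (node true a e) (∃ m ∈ W e, p m) := by
  choose b hb ψ hψ h0 h1 using fun m : W e => h m m.2
  refine ⟨_, .sigma ha hne b hb ψ hψ, ?_, ?_⟩
  · rintro ⟨m, hm, hp⟩
    exact eq_bot_iff.2 (iInf_le_of_le ⟨m, hm⟩ (h0 ⟨m, hm⟩ hp).le)
  · intro hp
    exact iInf_eq_top.2 fun m => h1 m fun hm => hp ⟨m, m.2, hm⟩

theorem hasTruth_node_false {a e : ℕ} {p : ℕ → Prop} (ha : InO a) (hne : (W e).Nonempty)
    (h : ∀ m ∈ W e, ∃ b, LtO b a ∧ MemberHasTruth ν I false b m (p m)) :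
    HasTruth ν I false a (node false a e) (∀ m ∈ W e, p m) := by
  choose b hb ψ hψ h0 h1 using fun m : W e => h m m.2
  refine ⟨_, .pi ha hne b hb ψ hψ, ?_, ?_⟩
  · intro hp
    exact iSup_eq_bot.2 fun m => h0 m (hp m m.2)
  · intro hp
    push Not at hp
    obtain ⟨m, hm, hp⟩ := hp
    exact eq_top_iff.2 (le_iSup_of_le ⟨m, hm⟩ (h1 ⟨m, hm⟩ hp).ge)

/-- Well-founded induction on the rank: moves lower it and reverse the polarity, so the members of a
`Σ` sentence are `Π` sentences at smaller notations, and `Val` obeys the same recursion as the truth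
value. -/
theorem hasTruth_game [Nonempty M] {α : Type*} {s : α → Bool} {τ : α → Part ℕ}
    {step : α → ℕ → Part α} {F : α → Part ℕ} {e : α → ℕ} (he : e.Injective)
    (hF : ∀ x, F x = (τ x).map fun t => node (s x) t (e x))
    (hW : ∀ x, W (e x) =
      {m | m = neutral (s x) ∨ ∃ i, ∃ y ∈ step x i, ∃ c ∈ F y, m = Nat.pair 0 c})
    {Good Val : α → Prop}
    (hgood : ∀ x, Good x → ∃ T ∈ τ x, InO T ∧ LtO 1 T ∧
      ∀ i, ∀ y ∈ step x i, Good y ∧ s y = !s x ∧ ∃ T' ∈ τ y, LtO T' T)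
    (htrue : ∀ x, Good x → s x = true → (Val x ↔ ∃ i, ∃ y ∈ step x i, Val y))
    (hfalse : ∀ x, Good x → s x = false → (Val x ↔ ∀ i, ∀ y ∈ step x i, Val y))
    (x : α) (hx : Good x) : ∃ T, ∃ c ∈ F x, HasTruth ν I (s x) T c (Val x) := by
  have hmem : ∀ {x T}, T ∈ τ x → node (s x) T (e x) ∈ F x := by
    intro x T hT
    rw [hF]
    exact Part.mem_map _ hT
  -- Needed because the truth of a member is expressed through its code, which must therefore
  -- determine the position.
  have hFinj : ∀ {x y c}, c ∈ F x → c ∈ F y → x = y := by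
    intro x y c hx hy
    rw [hF, Part.mem_map_iff] at hx hy
    obtain ⟨T, -, rfl⟩ := hx
    obtain ⟨T', -, h⟩ := hy
    exact (he (node_injective h)).symm
  have key : ∀ T, Acc LtO T → ∀ x, Good x → T ∈ τ x →
      HasTruth ν I (s x) T (node (s x) T (e x)) (Val x) := by
    intro T hT
    induction hT with
    | intro T _ ih =>
      intro x hx hTx
      obtain ⟨T', hT', hTO, hT1, hchild⟩ := hgood x hx
      obtain rfl := Part.mem_unique hTx hT'
      have hne : (W (e x)).Nonempty := ⟨neutral (s x), by rw [hW]; exact .inl rfl⟩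
      have hmember : ∀ i, ∀ y ∈ step x i, ∀ c ∈ F y, ∃ b, LtO b T ∧
          MemberHasTruth ν I (s x) b (Nat.pair 0 c) (Val y) := by
        intro i y hy c hc
        obtain ⟨hyg, hys, T', hT', hlt⟩ := hchild i y hy
        obtain rfl := Part.mem_unique hc (hmem hT')
        have := ih T' hlt y hyg hT'
        generalize node (s y) T' (e y) = c at this
        rw [hys] at this
        exact ⟨T', hlt, this.member⟩
      have hex : ∀ i, ∀ y ∈ step x i, ∃ c ∈ F y, Nat.pair 0 c ∈ W (e x) := by
        intro i y hy
        obtain ⟨-, -, T', hT', -⟩ := hchild i y hy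
        exact ⟨_, hmem hT', by rw [hW]; exact .inr ⟨i, y, hy, _, hmem hT', rfl⟩⟩
      have hneutral : ∀ c s, neutral s ≠ Nat.pair 0 c := by
        intro c s h
        simp [neutral, Nat.pair_eq_pair] at h
      cases hs : s x
      -- This `p` holds vacuously at the neutral member, whose first component is `1` instead of
      -- `0`.
      · have := hasTruth_node_false (ν := ν) (I := I) (e := e x)
          (p := fun m => ∀ i, ∀ y ∈ step x i, ∀ c ∈ F y, m = Nat.pair 0 c → Val y) hTO hne ?_
        · refine this.congr ?_
          rw [hfalse x hx hs]
          constructor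
          · intro h i y hy
            obtain ⟨c, hc, hcW⟩ := hex i y hy
            exact h _ hcW i y hy c hc rfl
          · exact fun h m _ i y hy c _ _ => h i y hy
        · intro m hm
          rw [hW] at hm
          rcases hm with rfl | ⟨i, y, hy, c, hc, rfl⟩
          · refine ⟨1, hT1, ?_⟩
            rw [hs]
            exact (memberHasTruth_neutral false).congr (by simp [hneutral])
          · obtain ⟨b, hb, h⟩ := hmember i y hy c hc
            refine ⟨b, hb, ?_⟩
            rw [hs] at h
            refine h.congr ?_
            constructor
            · intro h j z hz d hd hcd
              simp only [Nat.pair_eq_pair, true_and] at hcd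
              subst hcd
              rwa [hFinj hd hc]
            · exact fun h => h i y hy c hc rfl
      · have := hasTruth_node_true (ν := ν) (I := I) (e := e x)
          (p := fun m => ∃ i, ∃ y ∈ step x i, ∃ c ∈ F y, m = Nat.pair 0 c ∧ Val y) hTO hne ?_
        · refine this.congr ?_
          rw [htrue x hx hs]
          constructor
          · rintro ⟨m, -, i, y, hy, c, -, -, hv⟩
            exact ⟨i, y, hy, hv⟩
          · rintro ⟨i, y, hy, hv⟩
            obtain ⟨c, hc, hcW⟩ := hex i y hy
            exact ⟨_, hcW, i, y, hy, c, hc, rfl, hv⟩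
        · intro m hm
          rw [hW] at hm
          rcases hm with rfl | ⟨i, y, hy, c, hc, rfl⟩
          · refine ⟨1, hT1, ?_⟩
            rw [hs]
            exact (memberHasTruth_neutral true).congr (by simp [hneutral])
          · obtain ⟨b, hb, h⟩ := hmember i y hy c hc
            refine ⟨b, hb, ?_⟩
            rw [hs] at h
            refine h.congr ?_
            constructor
            · exact fun h => ⟨i, y, hy, c, hc, rfl, h⟩
            · rintro ⟨j, z, hz, d, hd, hcd, hv⟩
              simp only [Nat.pair_eq_pair, true_and] at hcd
              subst hcd
              rwa [hFinj hc hd]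
  obtain ⟨T, hT, hTO, -⟩ := hgood x hx
  exact ⟨T, _, hmem hT, key T hTO.acc x hx hT⟩

end Truth

/-! ### Describing membership in the sets of the hyperarithmetic hierarchy -/

/-- The set `H(a)`, for `a` in Kleene's `𝒪`. -/
def hypSet (a : ℕ) : Set ℕ := {v | ∃ X, IsH a X ∧ v ∈ X}

theorem IsH.hypSet_eq {a : ℕ} {X : Set ℕ} (h : IsH a X) : hypSet a = X := by
  ext v
  constructor
  · rintro ⟨Y, hY, hv⟩
    rwa [isH_unique h hY]
  · exact fun hv => ⟨X, h, hv⟩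

theorem isH_hypSet {a : ℕ} (h : InO a) : IsH a (hypSet a) := by
  obtain ⟨X, hX, -⟩ := existsUnique_isH h
  rwa [hX.hypSet_eq]

theorem hypSet_one : hypSet 1 = ∅ := IsH.one.hypSet_eq

theorem hypSet_two_pow {a : ℕ} (h : InO a) : hypSet (2 ^ a) = jump (hypSet a) :=
  (isH_hypSet h).succ.hypSet_eq

theorem hypSet_lim {e : ℕ} (h : InO (3 * 5 ^ e)) : hypSet (3 * 5 ^ e) =
    {x | LtO x.unpair.1 (3 * 5 ^ e) ∧ x.unpair.2 ∈ hypSet x.unpair.1} :=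
  (IsH.lim hypSet fun _ hu => isH_hypSet (h.of_ltO hu)).hypSet_eq

theorem mem_jump {X : Set ℕ} {v : ℕ} : v ∈ jump X ↔ ∃ q : List (ℕ × Bool),
    (run v (Nat.pair v (Encodable.encode q))).Dom ∧ ∀ p ∈ q, (p.1 ∈ X ↔ p.2 = true) := Iff.rfl

/-! ### The membership game and its computability. -/

/-- Positions of the membership game: polarity, notation, and either a number `v` (with a flag that
tells whether the polarity agrees with the claim `v ∈ H(a)`) or a list of questions with answers. -/
abbrev Position : Type := Bool × ℕ × (ℕ × Bool ⊕ List (ℕ × Bool))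

/-- The claim made at a position. -/
def Position.Claim : Position → Prop
  | (s, a, .inl (v, m)) => v ∈ hypSet a ↔ s = m
  | (s, a, .inr q) => (∀ p ∈ q, (p.1 ∈ hypSet a ↔ p.2 = true)) ↔ s = false

/-- The position that is reached from a position with a number by a move. -/
def numberStep (enum : ℕ → ℕ → Part ℕ) (s : Bool) (a : ℕ) (v : ℕ) (i : ℕ) : Part Position :=
  notationCases
    -- For `b = 0` the notation is `1 = 2 ^ 0`: there are no moves, in accordance with `H(1) = ∅`.
    (fun b => bif decide (b = 0) then Part.none else
      (Encodable.decode (α := List (ℕ × Bool)) i : Part _).bind fun q =>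
        (run v (Nat.pair v (Encodable.encode q))).map fun _ => (!s, b, .inr q))
    -- The move is a witness that the first component of `v` is below `a`. The flag `false` offsets
    -- the reversed polarity.
    (fun _ => (enum a i).bind fun u => bif decide (u = v.unpair.1) then
      Part.some (!s, u, .inl (v.unpair.2, false)) else Part.none) a

/-- The moves of the membership game. -/
def Position.step (enum : ℕ → ℕ → Part ℕ) (x : Position) (i : ℕ) : Part Position :=
  Sum.casesOn x.2.2
    (fun vm => bif vm.2 then numberStep enum x.1 x.2.1 vm.1 i
      -- A single dummy move, which only brings the polarity into agreement with the claim.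
      else Part.some (!x.1, x.2.1, .inl (vm.1, true)))
    (fun q => (q[i]? : Part _).map fun p => (!x.1, x.2.1, .inl p))

/-- The notation attached to a position. -/
def Position.rank (t : ℕ → Part ℕ) (x : Position) : Part ℕ :=
  (t x.2.1).map fun T =>
    -- At a fixed notation play goes from a list to a number, and from flag `false` to flag `true`,
    -- so the rank drops each time. Changing the notation is covered by the stretching.
    Sum.casesOn x.2.2 (fun vm => bif vm.2 then T else 2 ^ T) fun _ => 2 ^ 2 ^ T

theorem partrec_rank {t : ℕ → Part ℕ} (ht : Partrec t) : Partrec (Position.rank t) := by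
  refine Partrec.map (ht.comp (Computable.fst.comp .snd)) ?_
  refine Computable.sumCasesOn (Computable.snd.comp (Computable.snd.comp .fst)) ?_ ?_
  · exact Computable.cond (Computable.snd.comp .snd) (Computable.snd.comp .fst)
      (computable_two_pow.comp (Computable.snd.comp .fst))
  · exact computable_two_pow.comp (computable_two_pow.comp (Computable.snd.comp .fst))

theorem partrec_numberStep {enum : ℕ → ℕ → Part ℕ} (henum : Partrec₂ enum) :
    Partrec fun p : (Bool × ℕ) × ℕ × ℕ => numberStep enum p.1.1 p.1.2 p.2.1 p.2.2 := by
  have hs {β : Type} [Primcodable β] : Computable fun p : ((Bool × ℕ) × ℕ × ℕ) × β => !p.1.1.1 :=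
    Primrec.not.to_comp.comp (Computable.fst.comp (Computable.fst.comp .fst))
  have ha {β : Type} [Primcodable β] : Computable fun p : ((Bool × ℕ) × ℕ × ℕ) × β => p.1.1.2 :=
    Computable.snd.comp (Computable.fst.comp .fst)
  have hv {β : Type} [Primcodable β] : Computable fun p : ((Bool × ℕ) × ℕ × ℕ) × β => p.1.2.1 :=
    Computable.fst.comp (Computable.snd.comp .fst)
  have hi {β : Type} [Primcodable β] : Computable fun p : ((Bool × ℕ) × ℕ × ℕ) × β => p.1.2.2 :=
    Computable.snd.comp (Computable.snd.comp .fst)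
  have hdec : Computable₂ fun m n : ℕ => decide (m = n) := (PrimrecPred.decide Primrec.eq).to_comp
  refine partrec_notationCases (Computable.snd.comp .fst) ?_ ?_
  · refine Partrec.cond (hdec.comp .snd (.const 0)) Partrec.none ?_
    refine Partrec.bind (Computable.ofOption (Computable.decode.comp hi)) ?_
    refine Partrec.map (partrec₂_run.comp (hv.comp .fst)
      (Primrec₂.natPair.to_comp.comp (hv.comp .fst) (Computable.encode.comp .snd))) ?_
    exact (hs.comp (Computable.fst.comp .fst)).pair
      ((Computable.snd.comp (Computable.fst.comp .fst)).pair
        (Computable.sumInr.comp (Computable.snd.comp .fst)))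
  · refine Partrec.bind (henum.comp ha hi) ?_
    have hv' {β γ : Type} [Primcodable β] [Primcodable γ] :
        Computable fun p : (((Bool × ℕ) × ℕ × ℕ) × β) × γ => p.1.1.2.1.unpair :=
      Computable.unpair.comp (hv.comp .fst)
    refine Partrec.cond (hdec.comp .snd (Computable.fst.comp hv')) ?_ Partrec.none
    exact ((hs.comp .fst).pair (Computable.snd.pair (Computable.sumInl.comp
      ((Computable.snd.comp hv').pair (.const false))))).partrec

theorem partrec₂_step {enum : ℕ → ℕ → Part ℕ} (henum : Partrec₂ enum) :
    Partrec₂ (Position.step enum) := by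
  have hs {β : Type} [Primcodable β] : Computable fun p : (Position × ℕ) × β => p.1.1.1 :=
    Computable.fst.comp (Computable.fst.comp .fst)
  have ha {β : Type} [Primcodable β] : Computable fun p : (Position × ℕ) × β => p.1.1.2.1 :=
    Computable.fst.comp (Computable.snd.comp (Computable.fst.comp .fst))
  have hi {β : Type} [Primcodable β] : Computable fun p : (Position × ℕ) × β => p.1.2 :=
    Computable.snd.comp .fst
  have hns {β : Type} [Primcodable β] : Computable fun p : (Position × ℕ) × β => !p.1.1.1 :=
    Primrec.not.to_comp.comp hs
  have hnum : Partrec fun p : (Position × ℕ) × ℕ × Bool =>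
      numberStep enum p.1.1.1 p.1.1.2.1 p.2.1 p.1.2 :=
    (partrec_numberStep henum).comp
      (g := fun p : (Position × ℕ) × ℕ × Bool => ((p.1.1.1, p.1.1.2.1), (p.2.1, p.1.2)))
      ((hs.pair ha).pair ((Computable.fst.comp .snd).pair hi))
  refine Partrec.sumCasesOn (Computable.snd.comp (Computable.snd.comp .fst)) ?_ ?_
  · refine Partrec.cond (Computable.snd.comp .snd) hnum ?_
    · exact (hns.pair (ha.pair (Computable.sumInl.comp
        ((Computable.fst.comp .snd).pair (.const true))))).partrec
  · refine Partrec.map (Computable.ofOption (Computable.list_getElem?.comp .snd hi)) ?_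
    exact (hns.comp .fst).pair ((ha.comp .fst).pair (Computable.sumInl.comp .snd))

theorem mem_numberStep_one {enum : ℕ → ℕ → Part ℕ} {s : Bool} {v i : ℕ} {y : Position} :
    y ∉ numberStep enum s 1 v i := by
  rw [numberStep, show 1 = 2 ^ 0 from rfl, notationCases_two_pow]
  simp

theorem mem_numberStep_two_pow {enum : ℕ → ℕ → Part ℕ} {s : Bool} {a v i : ℕ} {y : Position}
    (ha : a ≠ 0) : y ∈ numberStep enum s (2 ^ a) v i ↔
      ∃ q ∈ Encodable.decode (α := List (ℕ × Bool)) i,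
        (run v (Nat.pair v (Encodable.encode q))).Dom ∧ (!s, a, .inr q) = y := by
  rw [numberStep, notationCases_two_pow]
  simp [ha, Part.dom_iff_mem]

theorem mem_numberStep_lim {enum : ℕ → ℕ → Part ℕ} {s : Bool} {e v i : ℕ} {y : Position} :
    y ∈ numberStep enum s (3 * 5 ^ e) v i ↔
      v.unpair.1 ∈ enum (3 * 5 ^ e) i ∧ y = (!s, v.unpair.1, .inl (v.unpair.2, false)) := by
  rw [numberStep, notationCases_lim, Part.mem_bind_iff]
  constructor
  · rintro ⟨u, hu, hy⟩
    by_cases h : u = v.unpair.1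
    · subst h
      exact ⟨hu, by simpa using hy⟩
    · simp [h] at hy
  · rintro ⟨hu, rfl⟩
    exact ⟨_, hu, by simp⟩

/-- Reversing the polarity negates a claim, so the conjunctive rules are the negations of the
disjunctive ones. The latter unfold the jump, the limit stage of `H`, and the existence of a wrong
answer in a list. -/
theorem claim_iff_of_step {enum : ℕ → ℕ → Part ℕ} (henum : ∀ b a, LtO b a ↔ ∃ i, b ∈ enum a i)
    {x : Position} (hx : InO x.2.1) : x.Claim ↔
      bif x.1 then ∃ i, ∃ y ∈ x.step enum i, y.Claim else ∀ i, ∀ y ∈ x.step enum i, y.Claim := by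
  obtain ⟨s, a, (⟨v, m⟩ | q)⟩ := x
  · cases m
    · cases s <;> simp [Position.step, Position.Claim]
    · change InO a at hx
      change (v ∈ hypSet a ↔ s = true) ↔ bif s then ∃ i, ∃ y ∈ numberStep enum s a v i, y.Claim
        else ∀ i, ∀ y ∈ numberStep enum s a v i, y.Claim
      cases hx with
      | one => cases s <;> simp [hypSet_one, mem_numberStep_one]
      | @succ a ha =>
        rw [hypSet_two_pow ha, mem_jump]
        simp only [mem_numberStep_two_pow ha.pos.ne']
        have hclaim : ∀ q : List (ℕ × Bool), Position.Claim (!s, a, .inr q) ↔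
            ((∀ p ∈ q, (p.1 ∈ hypSet a ↔ p.2 = true)) ↔ s = true) := by
          intro q
          cases s <;> simp [Position.Claim]
        have hstep : ∀ {P : Position → Prop},
            (∃ i y, (∃ q ∈ Encodable.decode (α := List (ℕ × Bool)) i,
            (run v (Nat.pair v (Encodable.encode q))).Dom ∧ (!s, a, .inr q) = y) ∧ P y) ↔
            ∃ q : List (ℕ × Bool), (run v (Nat.pair v (Encodable.encode q))).Dom ∧
              P (!s, a, .inr q) := by
          intro P
          constructor
          · rintro ⟨i, y, ⟨q, -, hq, rfl⟩, hP⟩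
            exact ⟨q, hq, hP⟩
          · rintro ⟨q, hq, hP⟩
            exact ⟨Encodable.encode q, _, ⟨q, Encodable.encodek q, hq, rfl⟩, hP⟩
        cases s
        · simp only [Bool.false_eq_true, iff_false, cond_false]
          have := hstep (P := fun y => ¬ y.Claim)
          simp only [hclaim, Bool.false_eq_true, iff_false, not_not] at this
          rw [← this]
          push Not
          rfl
        · simp only [iff_true, cond_true]
          rw [hstep]
          simp only [hclaim, iff_true]
      | @lim e f hf hO hlt =>
        rw [hypSet_lim (.lim f hf hO hlt)]
        simp only [mem_numberStep_lim, Set.mem_ofPred_eq, henum]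
        cases s
        · simp [Position.Claim]
        · simp [Position.Claim]
  · have hstep : ∀ y : Position, (∃ i, y ∈ Position.step enum (s, a, .inr q) i) ↔
        ∃ p ∈ q, y = (!s, a, .inl p) := by
      intro y
      simp only [Position.step, Part.mem_map_iff, Part.mem_ofOption, List.mem_iff_getElem?]
      aesop
    change ((∀ p ∈ q, (p.1 ∈ hypSet a ↔ p.2 = true)) ↔ s = false) ↔
      bif s then ∃ i, ∃ y ∈ Position.step enum (s, a, .inr q) i, y.Claim
      else ∀ i, ∀ y ∈ Position.step enum (s, a, .inr q) i, y.Claim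
    cases s
    · rw [cond_false, iff_true_right rfl]
      constructor
      · intro h i y hy
        obtain ⟨⟨n, m⟩, hp, rfl⟩ := (hstep y).1 ⟨i, hy⟩
        exact (h _ hp).trans eq_comm
      · rintro h ⟨n, m⟩ hp
        obtain ⟨i, hi⟩ := (hstep _).2 ⟨_, hp, rfl⟩
        exact (h i _ hi).trans eq_comm
    · rw [cond_true, iff_false_right Bool.true_eq_false.mp]
      have hflip : ∀ {p : Prop} {m : Bool}, (p ↔ false = m) ↔ ¬ (p ↔ m = true) := by
        intro p m
        cases m <;> simp
      constructor
      · intro h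
        simp only [not_forall] at h
        obtain ⟨⟨n, m⟩, hp, hv⟩ := h
        obtain ⟨i, hi⟩ := (hstep _).2 ⟨_, hp, rfl⟩
        exact ⟨i, _, hi, hflip.2 hv⟩
      · rintro ⟨i, y, hy, hv⟩ h
        obtain ⟨⟨n, m⟩, hp, rfl⟩ := (hstep y).1 ⟨i, hy⟩
        exact hflip.1 hv (h _ hp)

/-- The code is chosen before the language, its numbering and the structure, since the only atomic
formula used is `d(x_0, x_0)`. -/
theorem exists_membership_code : ∃ F : ℕ → ℕ → Part ℕ, Partrec₂ F ∧
    ∀ a, InO a → ∀ v, ∃ c ∈ F a v, ∀ (L : MetricLanguage.{u, v}) (ν : L.Numbering)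
      (M : Type w) [MetricSpace M] [Nonempty M] (I : Interpretation L M),
      ∃ T, HasTruth ν I true T c (v ∈ hypSet a) := by
  obtain ⟨enum, henum, henum'⟩ := exists_enum_ltO
  obtain ⟨t, ht, ht'⟩ := exists_stretch
  obtain ⟨F, e, hF, he, hFe, hW⟩ := exists_game_code (s := fun x : Position => x.1) .fst
    (partrec_rank ht) (partrec₂_step henum)
  have hstart : Computable fun p : ℕ × ℕ => ((true, p.1, .inl (p.2, true)) : Position) :=
    Computable.pair (.const true) (Computable.fst.pair (Computable.sumInl.comp
      (Computable.snd.pair (.const true))))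
  refine ⟨fun a v => F (true, a, .inl (v, true)), hF.comp hstart, fun a ha v => ?_⟩
  have hrank : ∀ {a A : ℕ} {s : Bool} {z}, A ∈ t a →
      (Sum.casesOn z (fun vm : ℕ × Bool => bif vm.2 then A else 2 ^ A)
        (fun _ : List (ℕ × Bool) => 2 ^ 2 ^ A)) ∈ Position.rank t (s, a, z) :=
    fun hA => Part.mem_map _ hA
  have hgood : ∀ x : Position, InO x.2.1 → ∃ T ∈ x.rank t, InO T ∧ LtO 1 T ∧
      ∀ i, ∀ y ∈ x.step enum i, InO y.2.1 ∧ y.1 = !x.1 ∧ ∃ T' ∈ y.rank t, LtO T' T := by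
    rintro ⟨s, a, z⟩ ha
    obtain ⟨A, hA, hAO, hA1, hAb⟩ := ht' a ha
    refine ⟨_, hrank hA, ?_⟩
    rcases z with ⟨v, m⟩ | q
    · cases m
      · refine ⟨hAO.succ, hA1.trans hAO.ltO_two_pow, fun i y hy => ?_⟩
        obtain rfl := Part.mem_some_iff.1 hy
        exact ⟨ha, rfl, _, hrank hA, hAO.ltO_two_pow⟩
      · refine ⟨hAO, hA1, fun i y hy => ?_⟩
        change y ∈ numberStep enum s a v i at hy
        change InO a at ha
        cases ha with
        | one => exact absurd hy mem_numberStep_one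
        | @succ b hb =>
          obtain ⟨q, -, -, rfl⟩ := (mem_numberStep_two_pow hb.pos.ne').1 hy
          obtain ⟨B, hB, hBA⟩ := hAb b hb.ltO_two_pow
          exact ⟨hb, rfl, _, hrank hB, hBA⟩
        | @lim e f hf hO hlt =>
          obtain ⟨hu, rfl⟩ := mem_numberStep_lim.1 hy
          have hlt' := (henum' _ _).2 ⟨i, hu⟩
          obtain ⟨B, hB, hBA⟩ := hAb _ hlt'
          have hbO := (InO.lim f hf hO hlt).of_ltO hlt'
          obtain ⟨B', hB', hBO, -⟩ := ht' _ hbO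
          obtain rfl := Part.mem_unique hB hB'
          exact ⟨hbO, rfl, _, hrank hB, hBO.succ.ltO_two_pow.trans hBA⟩
    · refine ⟨hAO.succ.succ, hA1.trans (hAO.ltO_two_pow.trans hAO.succ.ltO_two_pow),
        fun i y hy => ?_⟩
      obtain ⟨⟨v, m⟩, -, rfl⟩ := (Part.mem_map_iff _).1 hy
      refine ⟨ha, rfl, _, hrank hA, ?_⟩
      cases m
      exacts [hAO.succ.ltO_two_pow, hAO.ltO_two_pow.trans hAO.succ.ltO_two_pow]
  obtain ⟨A, hA, -⟩ := ht' a ha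
  have hc : node true A (e (true, a, .inl (v, true))) ∈ F (true, a, .inl (v, true)) := by
    rw [hFe]
    exact Part.mem_map (fun t => node true t _) (hrank hA)
  refine ⟨_, hc, fun L ν M _ _ I => ?_⟩
  obtain ⟨T, c, hc', h⟩ := hasTruth_game (ν := ν) (I := I) he hFe hW hgood
    (fun x hx hs => by simpa only [hs, cond_true] using claim_iff_of_step henum' hx)
    (fun x hx hs => by simpa only [hs, cond_false] using claim_iff_of_step henum' hx)
    (true, a, .inl (v, true)) ha
  obtain rfl := Part.mem_unique hc' hc
  exact ⟨T, h.congr (iff_true_right rfl)⟩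

/-! ### Oracles for the theory compute the hyperarithmetic hierarchy -/

/-- The natural number `1` or `0` according to whether `ratEnum m < 1 / 2`. -/
def ltHalf (m : ℕ) : ℕ :=
  bif decide (2 * m.unpair.1.unpair.1 < 2 * m.unpair.1.unpair.2 + (m.unpair.2 + 1)) then 1 else 0

theorem primrec_ltHalf : Primrec ltHalf := by
  have h : Primrec fun m : ℕ => m.unpair.1.unpair :=
    Primrec.unpair.comp (Primrec.fst.comp .unpair)
  have h2 {f : ℕ → ℕ} (hf : Primrec f) : Primrec fun m => 2 * f m :=
    Primrec.nat_mul.comp (.const 2) hf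
  refine Primrec.cond (PrimrecPred.decide (Primrec.nat_lt.comp (h2 (Primrec.fst.comp h))
    (Primrec.nat_add.comp (h2 (Primrec.snd.comp h))
      (Primrec.succ.comp (Primrec.snd.comp .unpair))))) (.const 1) (.const 0)

theorem ltHalf_eq (m : ℕ) : ltHalf m = if (ratEnum m : ℝ) < 1 / 2 then 1 else 0 := by
  have h : (2 * m.unpair.1.unpair.1 < 2 * m.unpair.1.unpair.2 + (m.unpair.2 + 1)) ↔
      (ratEnum m : ℝ) < 1 / 2 := by
    rw [ratEnum]
    push_cast
    rw [div_lt_div_iff₀ (by positivity) (by positivity), ← Nat.cast_lt (α := ℝ)]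
    push_cast
    constructor <;> intro h <;> linarith
  simp only [ltHalf, h, Bool.cond_decide]

theorem setTuringLE_of_computesTheory {L : MetricLanguage.{u, v}} {ν : L.Numbering} {M : Type w}
    [MetricSpace M] [Nonempty M] {I : Interpretation L M} {X : Set ℕ}
    (hX : ComputesTheory ν I X) {a : ℕ} (ha : InO a) : SetTuringLE (hypSet a) X := by
  obtain ⟨F, hF, hcode⟩ := exists_membership_code.{u, v, w}
  obtain ⟨f, hf, hval⟩ := hX
  -- Precision `2` means an error below `1/4`, enough to separate `0` from `1` at the threshold
  -- `1/2`.
  have hF' : Partrec fun n => (F a n).map fun c => Nat.pair c 2 :=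
    Partrec.map (hF.comp (.const a) .id) (Primrec₂.natPair.to_comp.comp .snd (.const 2))
  have hcomp := ((Nat.Primrec.recursiveIn (Primrec.nat_iff.1 primrec_ltHalf)).comp hf).comp
    (Nat.Partrec.recursiveIn (Partrec.nat_iff.1 hF') (O := {char X}))
  refine RecursiveIn.iff_nat.2 (hcomp.of_eq fun n => ?_)
  obtain ⟨c, hc, hT⟩ := hcode a ha n
  obtain ⟨T, Φ, hΦ, h0, h1⟩ := hT L ν M I
  obtain ⟨m, hm, habs⟩ := hval c Φ ⟨_, _, hΦ⟩ 2
  rw [Part.eq_some_iff.2 hc, Part.map_some]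
  refine Eq.trans (b := Part.some (ltHalf m)) ?_ ?_
  · simp [Part.eq_some_iff.2 hm]
  rw [char, ltHalf_eq]
  rw [abs_lt] at habs
  congr 1
  by_cases hn : n ∈ hypSet a
  · have : Φ.truth I = 0 := congrArg Subtype.val (h0 hn)
    rw [if_pos hn, if_pos]
    rw [this] at habs
    norm_num at habs ⊢
    linarith
  · have : Φ.truth I = 1 := congrArg Subtype.val (h1 hn)
    rw [if_neg hn, if_neg]
    rw [this] at habs
    norm_num at habs ⊢
    linarith

/-! ### The use principle, and a set does not compute its jump -/

open Classical in
/-- The first `k` values of the characteristic function of `X`. -/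
noncomputable def initialSegment (X : Set ℕ) (k : ℕ) : List Bool :=
  (List.range k).map fun i => decide (i ∈ X)

/-- `G` computes `f` from finite parts of the oracle `X`. -/
structure Approximates (X : Set ℕ) (G : List Bool → ℕ → Part ℕ) (f : ℕ → Part ℕ) : Prop where
  partrec : Partrec₂ G
  sound : ∀ k n y, y ∈ G (initialSegment X k) n → y ∈ f n
  complete : ∀ n y, y ∈ f n → ∀ᶠ k in atTop, y ∈ G (initialSegment X k) n

theorem Approximates.of_partrec {X : Set ℕ} {f : ℕ → Part ℕ} (hf : Partrec f) :
    Approximates X (fun _ => f) f :=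
  ⟨hf.comp .snd, fun _ _ _ h => h, fun _ _ h => .of_forall fun _ => h⟩

theorem approximates_char (X : Set ℕ) :
    Approximates X (fun σ n => (σ[n]?.map Bool.toNat : Option ℕ)) (char X) := by
  classical
  have hval : ∀ k n, (initialSegment X k)[n]?.map Bool.toNat =
      if n < k then some (if n ∈ X then 1 else 0) else none := by
    intro k n
    by_cases h : n < k <;> by_cases hn : n ∈ X <;> simp [initialSegment, h, hn]
  have hchar : ∀ n, char X n = Part.some (if n ∈ X then 1 else 0) := by
    intro n
    by_cases hn : n ∈ X <;> simp [char, hn]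
  refine ⟨Computable.ofOption (Computable.option_map (Computable.list_getElem?.comp .fst .snd)
    ((Primrec.dom_finite Bool.toNat).to_comp.comp .snd)), fun k n y h => ?_, fun n y h => ?_⟩
  · rw [hval] at h
    rw [hchar]
    by_cases hn : n < k
    · simpa [hn] using h
    · simp [hn] at h
  · rw [hchar] at h
    filter_upwards [eventually_gt_atTop n] with k hk
    rw [hval, if_pos hk]
    exact h

theorem computable_decide_eq_zero : Computable fun n : ℕ => decide (n = 0) :=
  (PrimrecPred.decide (Primrec.eq.comp Primrec.id (Primrec.const 0))).to_comp

theorem mem_rfind_map {g : ℕ → Part ℕ} {n : ℕ} :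
    n ∈ Nat.rfind (fun n => (g n).map fun m => decide (m = 0)) ↔
      0 ∈ g n ∧ ∀ m < n, ∃ y ∈ g m, y ≠ 0 := by
  refine Nat.mem_rfind.trans (and_congr ?_ (forall₂_congr fun m _ => ?_))
  · refine (Part.mem_map_iff _).trans ?_
    simp
  · refine (Part.mem_map_iff _).trans ?_
    simp

/-- Induction on the derivation of `f`. A halting computation has finitely many subcomputations,
each correct from long enough initial segments; intersecting finitely many eventual statements
suffices, so no monotonicity of `G` is needed. -/
theorem exists_approximates {X : Set ℕ} {f : ℕ →. ℕ} (hf : Nat.RecursiveIn {char X} f) :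
    ∃ G, Approximates X G f := by
  induction hf with
  | zero => exact ⟨_, .of_partrec (Partrec.nat_iff.2 .zero)⟩
  | succ => exact ⟨_, .of_partrec (Partrec.nat_iff.2 .succ)⟩
  | left => exact ⟨_, .of_partrec (Partrec.nat_iff.2 .left)⟩
  | right => exact ⟨_, .of_partrec (Partrec.nat_iff.2 .right)⟩
  | oracle g hg =>
    obtain rfl : g = char X := hg
    exact ⟨_, approximates_char X⟩
  | @pair f h _ _ ihf ihh =>
    obtain ⟨F, hF⟩ := ihf
    obtain ⟨H, hH⟩ := ihh
    refine ⟨fun σ n => (F σ n).bind fun a => (H σ n).map fun b => Nat.pair a b, ?_, ?_, ?_⟩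
    · exact Partrec.bind hF.partrec (Partrec.map (hH.partrec.comp (Computable.fst.comp .fst)
        (Computable.snd.comp .fst)) (Primrec₂.natPair.to_comp.comp (Computable.snd.comp .fst) .snd))
    · intro k n y hy
      simp only [Part.mem_bind_iff, Part.mem_map_iff] at hy
      obtain ⟨a, ha, b, hb, rfl⟩ := hy
      simp only [Seq.seq, Part.map_eq_map, Part.bind_map, Part.mem_bind_iff, Part.mem_map_iff]
      exact ⟨a, hF.sound _ _ _ ha, b, hH.sound _ _ _ hb, rfl⟩
    · intro n y hy
      simp only [Seq.seq, Part.map_eq_map, Part.bind_map, Part.mem_bind_iff,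
        Part.mem_map_iff] at hy
      obtain ⟨a, ha, b, hb, rfl⟩ := hy
      filter_upwards [hF.complete _ _ ha, hH.complete _ _ hb] with k ha hb
      exact Part.mem_bind ha (Part.mem_map _ hb)
  | @comp f h _ _ ihf ihh =>
    obtain ⟨F, hF⟩ := ihf
    obtain ⟨H, hH⟩ := ihh
    refine ⟨fun σ n => (H σ n).bind (F σ), ?_, ?_, ?_⟩
    · exact Partrec.bind hH.partrec (hF.partrec.comp (Computable.fst.comp .fst) .snd)
    · intro k n y hy
      obtain ⟨a, ha, hy⟩ := Part.mem_bind_iff.1 hy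
      exact Part.mem_bind (hH.sound _ _ _ ha) (hF.sound _ _ _ hy)
    · intro n y hy
      obtain ⟨a, ha, hy⟩ := Part.mem_bind_iff.1 hy
      filter_upwards [hH.complete _ _ ha, hF.complete _ _ hy] with k ha hy
      exact Part.mem_bind ha hy
  | @prec f h _ _ ihf ihh =>
    obtain ⟨F, hF⟩ := ihf
    obtain ⟨H, hH⟩ := ihh
    refine ⟨fun σ p => Nat.rec (motive := fun _ => Part ℕ) (F σ p.unpair.1)
      (fun y IH => IH.bind fun i => H σ (Nat.pair p.unpair.1 (Nat.pair y i))) p.unpair.2,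
      ?_, ?_, ?_⟩
    · have hp {β : Type} [Primcodable β] :
          Computable fun p : (List Bool × ℕ) × β => p.1.2.unpair.1 :=
        Computable.fst.comp (Computable.unpair.comp (Computable.snd.comp .fst))
      exact Partrec.nat_rec (f := fun p : List Bool × ℕ => p.2.unpair.2)
        (g := fun p => F p.1 p.2.unpair.1)
        (h := fun p q => H p.1 (Nat.pair p.2.unpair.1 (Nat.pair q.1 q.2)))
        (Computable.snd.comp (Computable.unpair.comp .snd))
        (hF.partrec.comp .fst (Computable.fst.comp (Computable.unpair.comp .snd)))
        (hH.partrec.comp (Computable.fst.comp .fst) (Primrec₂.natPair.to_comp.comp hp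
          (Primrec₂.natPair.to_comp.comp (Computable.fst.comp .snd) (Computable.snd.comp .snd))))
    · intro k p y hy
      simp only at hy ⊢
      generalize p.unpair.1 = a at *
      generalize p.unpair.2 = n at *
      induction n generalizing y with
      | zero => exact hF.sound _ _ _ hy
      | succ n ih =>
        obtain ⟨i, hi, hy⟩ := Part.mem_bind_iff.1 hy
        exact Part.mem_bind (ih i hi) (hH.sound _ _ _ hy)
    · intro p y hy
      simp only at hy ⊢
      generalize p.unpair.1 = a at *
      generalize p.unpair.2 = n at *
      induction n generalizing y with
      | zero => exact hF.complete _ _ hy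
      | succ n ih =>
        obtain ⟨i, hi, hy⟩ := Part.mem_bind_iff.1 hy
        filter_upwards [ih i hi, hH.complete _ _ hy] with k hi hy
        exact Part.mem_bind hi hy
  | @rfind f _ ihf =>
    obtain ⟨F, hF⟩ := ihf
    refine ⟨fun σ a => Nat.rfind fun n => (F σ (Nat.pair a n)).map fun m => decide (m = 0),
      ?_, ?_, ?_⟩
    · refine Partrec.rfind (Partrec.map (hF.partrec.comp (Computable.fst.comp .fst)
        (Primrec₂.natPair.to_comp.comp (Computable.snd.comp .fst) .snd)) ?_)
      exact computable_decide_eq_zero.comp .snd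
    · intro k a n hn
      obtain ⟨h0, h⟩ := mem_rfind_map.1 hn
      refine mem_rfind_map.2 ⟨hF.sound _ _ _ h0, fun m hm => ?_⟩
      obtain ⟨y, hy, hy0⟩ := h m hm
      exact ⟨y, hF.sound _ _ _ hy, hy0⟩
    · intro a n hn
      obtain ⟨h0, h⟩ := (mem_rfind_map (g := fun n => f (Nat.pair a n))).1 hn
      have h' : ∀ᶠ k in atTop, ∀ m ∈ Set.Iio n,
          ∃ y ∈ F (initialSegment X k) (Nat.pair a m), y ≠ 0 := by
        refine (Set.finite_Iio n).eventually_all.2 fun m hm => ?_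
        obtain ⟨y, hy, hy0⟩ := h m hm
        filter_upwards [hF.complete _ _ hy] with k hk
        exact ⟨y, hk, hy0⟩
      filter_upwards [hF.complete _ _ h0, h'] with k h0 h'
      exact mem_rfind_map.2 ⟨h0, h'⟩

/-- The axioms are the `⟨n, q⟩` in which `q` answers exactly the questions `0, …, k - 1` in order,
and those answers make `G` output `0` at `n`. If the answers are correct, they form an initial
segment of `X`. -/
theorem exists_wRel_eq {X : Set ℕ} {f : ℕ →. ℕ} (hf : RecursiveIn {char X} f) :
    ∃ e, WRel e X = {n | 0 ∈ f n} := by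
  classical
  obtain ⟨G, hG⟩ := exists_approximates (RecursiveIn.iff_nat.1 hf)
  obtain ⟨e, he⟩ := exists_run_eq (f := fun x =>
      (Encodable.decode (α := List (ℕ × Bool)) x.unpair.2 :
        Part (List (ℕ × Bool))).bind fun q =>
        bif decide (q.map Prod.fst = List.range q.length) then
          (G (q.map Prod.snd) x.unpair.1).bind fun y =>
            bif decide (y = 0) then Part.some 0 else Part.none
        else Part.none) <| by
    refine Partrec.bind (Computable.ofOption (Computable.decode.comp
      (Computable.snd.comp .unpair))) (Partrec.cond ?_ ?_ Partrec.none)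
    · exact (PrimrecPred.decide (Primrec.eq.comp
        (Primrec.list_map Primrec.snd (Primrec.fst.comp₂ Primrec₂.right))
        (Primrec.list_range.comp (Primrec.list_length.comp Primrec.snd)))).to_comp
    · refine Partrec.bind (hG.partrec.comp
        (Primrec.list_map Primrec.snd (Primrec.snd.comp₂ Primrec₂.right)).to_comp
        (Computable.fst.comp (Computable.unpair.comp .fst))) ?_
      exact Partrec.cond (computable_decide_eq_zero.comp .snd) (Computable.const 0).partrec Partrec.none
  have hdom : ∀ n (q : List (ℕ × Bool)), Nat.pair n (Encodable.encode q) ∈ W e ↔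
      q.map Prod.fst = List.range q.length ∧ 0 ∈ G (q.map Prod.snd) n := by
    intro n q
    rw [mem_W, he]
    by_cases hq : q.map Prod.fst = List.range q.length
    · simp only [Nat.unpair_pair, Encodable.encodek, Part.coe_some, Part.bind_some, hq,
        decide_true, cond_true, true_and, Part.dom_iff_mem, Part.mem_bind_iff]
      constructor
      · rintro ⟨_, y, hy, h⟩
        by_cases h0 : y = 0
        · rwa [← h0]
        · simp [h0] at h
      · exact fun h => ⟨0, 0, h, by simp⟩
    · simp [hq]
  refine ⟨e, ?_⟩
  ext n
  constructor
  · rintro ⟨q, hq, hX⟩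
    obtain ⟨hfst, h0⟩ := (hdom n q).1 hq
    have : q.map Prod.snd = initialSegment X q.length := by
      rw [initialSegment, ← hfst, List.map_map]
      refine List.map_congr_left fun p hp => ?_
      simp [hX p hp]
    rw [this] at h0
    exact hG.sound _ _ _ h0
  · intro hn
    obtain ⟨k, hk⟩ := (hG.complete n 0 hn).exists
    refine ⟨(List.range k).map fun i => (i, decide (i ∈ X)), (hdom _ _).2 ⟨?_, ?_⟩, ?_⟩
    · simp [List.map_map, Function.comp_def]
    · simpa only [List.map_map, Function.comp_def, initialSegment] using hk
    · simp

/-- Otherwise the complement of the jump, where its characteristic function is `0`, would be c.e. in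
`X`; its index `e` is then in the jump if and only if it is not. -/
theorem not_setTuringLE_jump (X : Set ℕ) : ¬ SetTuringLE (jump X) X := by
  classical
  intro h
  obtain ⟨e, he⟩ := exists_wRel_eq h
  have h1 : e ∈ jump X ↔ e ∈ WRel e X := Iff.rfl
  have h2 : e ∈ WRel e X ↔ e ∉ jump X := by
    rw [he]
    change 0 ∈ char (jump X) e ↔ _
    by_cases hj : e ∈ jump X <;> simp [char, hj]
  tauto

end HypNum

theorem mainTheorem2 (L : HypNum.MetricLanguage.{u, v}) (ν : L.Numbering)
    (M : Type w) [MetricSpace M] [Nonempty M] (I : HypNum.Interpretation L M) :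
    (∀ X : Set ℕ, HypNum.ComputesTheory ν I X →
      ∀ Y : Set ℕ, HypNum.Hyperarithmetic Y → HypNum.SetTuringLE Y X) ∧
    (∀ X : Set ℕ, HypNum.Hyperarithmetic X → ¬ HypNum.ComputesTheory ν I X) := by
  constructor
  · rintro X hX Y ⟨a, Z, ha, hZ, hY⟩
    rw [← hZ.hypSet_eq] at hY
    exact hY.trans (HypNum.setTuringLE_of_computesTheory hX ha)
  · rintro X ⟨a, Z, ha, hZ, hXa⟩ hX
    rw [← hZ.hypSet_eq] at hXa
    -- Going one notation further, to `2 ^ a`, makes the oracle compute the jump of a set that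
    -- computes it.
    have h := HypNum.setTuringLE_of_computesTheory hX ha.succ
    rw [HypNum.hypSet_two_pow ha] at h
    exact HypNum.not_setTuringLE_jump _ (h.trans hXa)
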